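/- Let $\mathcal X$ be a finite set, let $\mathcal S(\mathcal X)$ be the set of probability distributions on $\mathcal X$, and let $R,S\subseteq\mathcal S(\mathcal X)$. Write $C:=\overline{\mathrm{co}}(S)$ for the closed convex hull of $S$. **Divergences.** For $\varrho,\sigma\in\mathcal S(\mathcal X)$ and $\alpha\in(1,\infty)$ let $D_\alpha(\varrho\|\sigma):=\frac{1}{\alpha-1}\log\sum_x\varrho(x)^\alpha\sigma(x)^{1-\alpha}$ if $\mathrm{supp}\,\varrho\subseteq\mathrm{supp}\,\sigma$ and $D_\alpha(\varrho\|\sigma):=+\infty$ otherwise; let $D_1:=D$ be the relative entropy, and $D_\infty(\varrho\|\sigma):=D^*_\infty(\varrho\|\sigma):=\inf\{\lambda\in\mathbb R:\varrho\le e^\lambda\sigma\}$ the max-relative entropy. Put $D(\varrho\|S):=\inf_{\sigma\in S}D(\varrho\|\sigma)$, $D^*_\infty(\varrho\|S):=\inf_{\sigma\in S}D^*_\infty(\varrho\|\sigma)$, $$H^*_r(\varrho\|\sigma):=\sup_{\alpha\in[1,\infty]}\tfrac{\alpha-1}{\alpha}\left[r-D_\alpha(\varrho\|\sigma)\right]$$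 (with $\frac{\infty-1}{\infty}:=1$ and $0\cdot(\pm\infty):=0$), and $H^*_r(R\|C):=\sup_{\varrho\in R,\,\sigma\in C}H^*_r(\varrho\|\sigma)$. **Hypotheses.** For $A\subseteq\mathcal S(\mathcal X)$ and $n\in\mathbb N$ let $A^{\otimes n}:=\{\sigma^{\otimes n}:\sigma\in A\}$ (composite i.i.d.), $A^{\otimes n}_{\mathrm{av}}:=\{\sigma_1\otimes\cdots\otimes\sigma_n:\sigma_1,\dots,\sigma_n\in A\}$ (arbitrarily varying), and let $A^{(n)}_{\mathrm{adv}}$ (adversarial) be the set of all distributions $p(x_1,\dots,x_n)=\prod_{k=1}^n q_k(x_k|x_1,\dots,x_{k-1})$ on $\mathcal X^n$ such that $q_k(\cdot|x_1,\dots,x_{k-1})\in A$ for all $k$ and all $x_1,\dots,x_{k-1}$. **Exponents.** A test sequence is a sequence of functions $T_n:\mathcal X^n\to[0,1]$. For a distribution $p$ on $\mathcal X^n$ write $p(T_n):=\sum_x p(x)T_n(x)$. For sets $S_n$ of distributions on $\mathcal X^n$, the $\{0\}$-relaxed strong converse exponent is $$\mathrm{sc}_r^{\{0\}}\left(R\|(S_n)_n\right):=\inf_{(T_n)}\left\{\sup_{\varrho\in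 R}\limsup_{n\to\infty}-\tfrac1n\log\varrho^{\otimes n}(T_n)\;:\;\liminf_{n\to\infty}-\tfrac1n\log\sup_{p\in S_n}p(T_n)\ge r\right\},$$ and for $A\subseteq\mathcal S(\mathcal X)$ the $\{0,1\}$-relaxed one is $$\mathrm{sc}_r^{\{0,1\}}(R\|A):=\inf_{(T_n)}\left\{\sup_{\varrho\in R}\limsup_{n\to\infty}-\tfrac1n\log\varrho^{\otimes n}(T_n)\;:\;\inf_{\sigma\in A}\liminf_{n\to\infty}-\tfrac1n\log\sigma^{\otimes n}(T_n)\ge r\right\}.$$ Write $\mathrm{sc}_r(\varrho\|\sigma)$ for the common value of these when $R=\{\varrho\}$ and $S_n=\{\sigma^{\otimes n}\}$, $A=\{\sigma\}$. **Statement.** Assume that $D(\varrho\|S)<D^*_\infty(\varrho\|S)$ for every $\varrho\in R$. Then for every $r>0$, $$\begin{aligned} H^*_r(R\|C)&=\sup_{\varrho\in R,\,\sigma\in C}\mathrm{sc}_r(\varrho\|\sigma)\\ &=\mathrm{sc}_r^{\{0\}}\left(R\|(C^{(n)}_{\mathrm{adv}})_n\right)=\mathrm{sc}_r^{\{0\}}\left(R\|(S^{(n)}_{\mathrm{adv}})_n\right)\\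 &=\mathrm{sc}_r^{\{0\}}\left(R\|(S^{\otimes n}_{\mathrm{av}})_n\right)=\mathrm{sc}_r^{\{0\}}\left(R\|(C^{\otimes n}_{\mathrm{av}})_n\right)\\ &=\mathrm{sc}_r^{\{0\}}\left(R\|(C^{\otimes n})_n\right)=\mathrm{sc}_r^{\{0,1\}}(R\|C). \end{aligned}$$ -/

import Mathlib

open Filter
open scoped ENNReal

noncomputable section

namespace StateDiscrimination

/-! ### Binary state discrimination on finite classical systems

States on a finite set `Ω` are the elements of `stdSimplex ℝ Ω`; the `n`-fold product of the
system `X` is `Fin n → X`. -/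

/-- A (classical) test: a function with values in `[0, 1]`, the outcome `1` accepting the null
hypothesis. -/
def IsTest {Ω : Type*} (T : Ω → ℝ) : Prop :=
  ∀ ω, 0 ≤ T ω ∧ T ω ≤ 1

/-- The type I error `sup_{ρ ∈ R} ρ(1 - T)` of the null hypothesis `R`. -/
def typeIError {Ω : Type*} [Fintype Ω] (R : Set (Ω → ℝ)) (T : Ω → ℝ) : ℝ≥0∞ :=
  ⨆ ρ ∈ R, ENNReal.ofReal (∑ ω, ρ ω * (1 - T ω))

/-- The type II error `sup_{σ ∈ S} σ(T)` of the alternative hypothesis `S`. -/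
def typeIIError {Ω : Type*} [Fintype Ω] (S : Set (Ω → ℝ)) (T : Ω → ℝ) : ℝ≥0∞ :=
  ⨆ σ ∈ S, ENNReal.ofReal (∑ ω, σ ω * T ω)

/-- The exponential rate `-(1/n) log p`, equal to `+∞` if `p = 0` and `n ≥ 1`. -/
def rate (n : ℕ) (p : ℝ≥0∞) : EReal :=
  ((-(1 / (n : ℝ)) : ℝ) : EReal) * ENNReal.log p

/-- `limsup_n -(1/n) log (1 - α_n(R_n | T_n))`. -/
def successRate {X : Type*} [Fintype X] (R : ∀ n : ℕ, Set ((Fin n → X) → ℝ))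
    (T : ∀ n : ℕ, (Fin n → X) → ℝ) : EReal :=
  limsup (fun n => rate n (1 - typeIError (R n) (T n))) atTop

/-- `liminf_n -(1/n) log β_n(S_n | T_n)`. -/
def typeIIRate {X : Type*} [Fintype X] (S : ∀ n : ℕ, Set ((Fin n → X) → ℝ))
    (T : ∀ n : ℕ, (Fin n → X) → ℝ) : EReal :=
  liminf (fun n => rate n (typeIIError (S n) (T n))) atTop

/-- The strong converse exponent of `(R_n)` versus `(S_n)` with type II error exponent `r`. -/
def scExponent {X : Type*} [Fintype X] (r : ℝ) (R S : ∀ n : ℕ, Set ((Fin n → X) → ℝ)) : EReal :=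
  ⨅ (T : ∀ n : ℕ, (Fin n → X) → ℝ) (_ : ∀ n, IsTest (T n)) (_ : (r : EReal) ≤ typeIIRate S T),
    successRate R T

/-- The `{0}`-relaxed strong converse exponent for a consistent null hypothesis
`R_n = {ρ i n | i ∈ I}`: the rate of the type I success probability is taken for each `i`
separately, before the supremum over `i`. -/
def scExponentRelaxed0 {X I : Type*} [Fintype X] (r : ℝ) (ρ : I → ∀ n : ℕ, (Fin n → X) → ℝ)
    (S : ∀ n : ℕ, Set ((Fin n → X) → ℝ)) : EReal :=
  ⨅ (T : ∀ n : ℕ, (Fin n → X) → ℝ) (_ : ∀ n, IsTest (T n)) (_ : (r : EReal) ≤ typeIIRate S T),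
    ⨆ i, successRate (fun n => {ρ i n}) T

/-- The `{0,1}`-relaxed strong converse exponent for consistent null and alternative hypotheses:
in addition, the rate of the type II error is taken for each alternative `j` separately. -/
def scExponentRelaxed01 {X I J : Type*} [Fintype X] (r : ℝ)
    (ρ : I → ∀ n : ℕ, (Fin n → X) → ℝ) (σ : J → ∀ n : ℕ, (Fin n → X) → ℝ) : EReal :=
  ⨅ (T : ∀ n : ℕ, (Fin n → X) → ℝ) (_ : ∀ n, IsTest (T n))
    (_ : (r : EReal) ≤ ⨅ j, typeIIRate (fun n => {σ j n}) T),
    ⨆ i, successRate (fun n => {ρ i n}) T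

/-! ### The hypotheses -/

/-- The i.i.d. state `ρ^{⊗ n}`. -/
def iid {X : Type*} (ρ : X → ℝ) (n : ℕ) : (Fin n → X) → ℝ :=
  fun x => ∏ k, ρ (x k)

/-- The family `(ρ^{⊗ n})_n`, indexed by `ρ ∈ R`. -/
def iidFamily {X : Type*} (R : Set (X → ℝ)) : R → ∀ n : ℕ, (Fin n → X) → ℝ :=
  fun ρ n => iid (ρ : X → ℝ) n

/-- Composite i.i.d. hypothesis: `{σ^{⊗ n} | σ ∈ S}`. -/
def compositeIID {X : Type*} (S : Set (X → ℝ)) (n : ℕ) : Set ((Fin n → X) → ℝ) :=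
  {p | ∃ σ ∈ S, p = iid σ n}

/-- Arbitrarily varying hypothesis: `{σ_1 ⊗ ⋯ ⊗ σ_n | σ_1, …, σ_n ∈ S}`. -/
def arbVarying {X : Type*} (S : Set (X → ℝ)) (n : ℕ) : Set ((Fin n → X) → ℝ) :=
  {p | ∃ σ : Fin n → X → ℝ, (∀ k, σ k ∈ S) ∧ p = fun x => ∏ k, σ k (x k)}

/-- Adversarial hypothesis: all `p(x) = ∏_k q_k(x_k | x_1, …, x_{k-1})` where every conditional
distribution `q_k(· | x_1, …, x_{k-1})` is in `S`. -/
def adversarial {X : Type*} (S : Set (X → ℝ)) (n : ℕ) : Set ((Fin n → X) → ℝ) :=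
  {p | ∃ q : (k : Fin n) → (Fin k → X) → X → ℝ, (∀ k y, q k y ∈ S) ∧
    p = fun x => ∏ k : Fin n, q k (fun j => x (Fin.castLE k.isLt.le j)) (x k)}

/-- The strong converse exponent of the simple i.i.d. problem `ρ` versus `σ`. -/
def scSimple {X : Type*} [Fintype X] (r : ℝ) (ρ σ : X → ℝ) : EReal :=
  scExponent r (fun n => {iid ρ n}) (fun n => {iid σ n})

/-! ### Divergences -/

/-- `supp ρ ⊆ supp σ`. -/
def SuppLE {X : Type*} (ρ σ : X → ℝ) : Prop :=
  ∀ x, σ x = 0 → ρ x = 0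

open Classical in
/-- The relative entropy `D(ρ‖σ)`. -/
def relEntropy {X : Type*} [Fintype X] (ρ σ : X → ℝ) : EReal :=
  if SuppLE ρ σ then ((∑ x, ρ x * (Real.log (ρ x) - Real.log (σ x)) : ℝ) : EReal) else ⊤

/-- The max-relative entropy `inf {λ ∈ ℝ | ρ ≤ e^λ σ}`. -/
def maxRelEntropy {X : Type*} (ρ σ : X → ℝ) : EReal :=
  ⨅ (l : ℝ) (_ : ∀ x, ρ x ≤ Real.exp l * σ x), (l : EReal)

open Classical in
/-- `Q_α(ρ‖σ) = ∑_x ρ(x)^α σ(x)^{1-α}` if `supp ρ ⊆ supp σ`, and `+∞` otherwise (for `α > 1`). -/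
def renyiQ {X : Type*} [Fintype X] (α : ℝ) (ρ σ : X → ℝ) : ℝ≥0∞ :=
  if SuppLE ρ σ then ENNReal.ofReal (∑ x, ρ x ^ α * σ x ^ (1 - α)) else ⊤

open Classical in
/-- The Rényi divergence of order `α ∈ [1, ∞]`: the relative entropy at `α = 1`, the max-relative
entropy at `α = ∞`, and `(α - 1)⁻¹ log Q_α` in between. -/
def renyiDiv {X : Type*} [Fintype X] (α : ℝ≥0∞) (ρ σ : X → ℝ) : EReal :=
  if α = 1 then relEntropy ρ σ
  else if α = ⊤ then maxRelEntropy ρ σ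
  else (((α.toReal - 1)⁻¹ : ℝ) : EReal) * ENNReal.log (renyiQ α.toReal ρ σ)

open Classical in
/-- The factor `(α - 1) / α`, equal to `1` at `α = ∞`. -/
def hoeffdingFactor (α : ℝ≥0∞) : ℝ :=
  if α = ⊤ then 1 else (α.toReal - 1) / α.toReal

/-- The Hoeffding anti-divergence
`H*_r(ρ‖σ) = sup_{α ∈ [1,∞]} ((α - 1)/α) [r - D_α(ρ‖σ)]`, with `0 · (±∞) = 0`. -/
def hoeffdingAnti {X : Type*} [Fintype X] (r : ℝ) (ρ σ : X → ℝ) : EReal :=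
  ⨆ (α : ℝ≥0∞) (_ : 1 ≤ α), (hoeffdingFactor α : EReal) * ((r : EReal) - renyiDiv α ρ σ)

/-- The Hoeffding anti-divergence of two sets of states. -/
def hoeffdingAntiSet {X : Type*} [Fintype X] (r : ℝ) (R S : Set (X → ℝ)) : EReal :=
  ⨆ ρ ∈ R, ⨆ σ ∈ S, hoeffdingAnti r ρ σ

end StateDiscrimination

end

namespace StateDiscrimination

/-! ### Exponential rates -/

/-! All exponents lie on one cycle of inequalities. Passing from i.i.d. to arbitrarily varying to
adversarial alternatives, or from `S` to `C`, only makes the test's task harder. Arbitrarily varying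
`C` is no harder than `S`, because the type II error is affine and continuous in each factor. It
remains to bound the easiest problem from below and the hardest from above by the Hoeffding
anti-divergence.

Lower bound (`hoeffdingAnti_le_successRate`): Hölder's inequality gives `ρ^n(T) ≤ Q_α^{n/α}
σ^n(T)^{(α-1)/α}` for each pair `ρ`, `σ` and each order `α`.

Upper bound (`scExponentRelaxed0_adversarial_le`): call `E ≥ 0` an e-value if `σ(E) ≤ 1` on `C`.
Products of e-values keep expectation at most one against an adversary, so by Markov's inequality a
thresholded mixture of such products has type II exponent at least `r`. Changing measure from `ρ` to
a state `τ` shows that its success rate under `ρ` is at most `D(τ‖ρ) + (r - τ(log E))⁺` for every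
`E` in the mixture (`limsup_rate_le`). A countable dense family of e-values makes one test serve all
`ρ`.

To reach the Hoeffding value, maximise it jointly over the order `1 + u` and `σ`
(`exists_approx_saddle`). With `τ ∝ ρ^{1+u} σ^{-u}`, stationarity in `σ` says that `τ/σ` is an
e-value, and stationarity in `u` says that `D(τ‖σ) = r`; the trade-off then equals the maximum. Both
suprema point the same way, so no minimax theorem is needed. -/

lemma rate_antitone (n : ℕ) : Antitone (rate n) := by
  intro p q h
  have h1 := mul_le_mul_of_nonneg_left (ENNReal.log_le_log h)
    (show (0 : EReal) ≤ ((1 / (n : ℝ) : ℝ) : EReal) from by exact_mod_cast (by positivity))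
  simpa only [rate, EReal.coe_neg, neg_mul, EReal.neg_le_neg_iff] using h1

lemma rate_ofReal_of_pos (n : ℕ) {a : ℝ} (ha : 0 < a) :
    rate n (ENNReal.ofReal a) = ((-(1 / (n : ℝ)) * Real.log a : ℝ) : EReal) := by
  rw [rate, ENNReal.log_ofReal_of_pos ha, ← EReal.coe_mul]

lemma le_rate_ofReal_iff {n : ℕ} (hn : 0 < n) (a c : ℝ) :
    (c : EReal) ≤ rate n (ENNReal.ofReal a) ↔ a ≤ Real.exp (-(n * c)) := by
  have hn' : (0 : ℝ) < n := by exact_mod_cast hn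
  rcases le_or_gt a 0 with ha | ha
  · have h1 : rate n (ENNReal.ofReal a) = ⊤ := by
      rw [rate, ENNReal.ofReal_of_nonpos ha, ENNReal.log_zero,
        EReal.coe_mul_bot_of_neg (by simpa using hn)]
    simp only [h1, le_top, true_iff]
    exact ha.trans (Real.exp_pos _).le
  · rw [rate_ofReal_of_pos n ha, EReal.coe_le_coe_iff, ← Real.log_le_iff_le_exp ha,
      neg_mul, one_div, le_neg, inv_mul_le_iff₀ hn', mul_neg]

lemma rate_ofReal_le {n : ℕ} (hn : 0 < n) {a c : ℝ} (h : Real.exp (-(n * c)) ≤ a) :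
    rate n (ENNReal.ofReal a) ≤ (c : EReal) := by
  have hn' : (0 : ℝ) < n := by exact_mod_cast hn
  have ha := (Real.exp_pos _).trans_le h
  rw [rate_ofReal_of_pos n ha, EReal.coe_le_coe_iff, neg_mul, one_div, neg_le,
    le_inv_mul_iff₀ hn', mul_neg]
  exact (Real.le_log_iff_exp_le ha).2 h

/-! ### Product states -/

lemma iid_nonneg {X : Type*} {ρ : X → ℝ} (h : ∀ x, 0 ≤ ρ x) (n : ℕ) (x : Fin n → X) :
    0 ≤ iid ρ n x :=
  Finset.prod_nonneg fun _ _ => h _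

lemma sum_iid {X : Type*} [Fintype X] (f : X → ℝ) (n : ℕ) :
    ∑ x, iid f n x = (∑ a, f a) ^ n :=
  (Fintype.sum_pow f n).symm

lemma typeIIError_singleton {Ω : Type*} [Fintype Ω] (σ T : Ω → ℝ) :
    typeIIError {σ} T = ENNReal.ofReal (∑ ω, σ ω * T ω) := by
  simp [typeIIError]

lemma one_sub_typeIError_singleton {Ω : Type*} [Fintype Ω] {ρ T : Ω → ℝ}
    (hρ : ρ ∈ stdSimplex ℝ Ω) (hT : IsTest T) :
    1 - typeIError {ρ} T = ENNReal.ofReal (∑ ω, ρ ω * T ω) := by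
  have h0 : 0 ≤ ∑ ω, ρ ω * (1 - T ω) :=
    Finset.sum_nonneg fun ω _ => mul_nonneg (hρ.1 ω) (by linarith [(hT ω).2])
  have h1 : ∑ ω, ρ ω * (1 - T ω) = 1 - ∑ ω, ρ ω * T ω := by
    simp only [mul_sub, mul_one, Finset.sum_sub_distrib, hρ.2]
  simp only [typeIError, Set.mem_singleton_iff, iSup_iSup_eq_left]
  rw [← ENNReal.ofReal_one, ← ENNReal.ofReal_sub _ h0, h1]
  congr 1
  ring

lemma iid_mem_stdSimplex {X : Type*} [Fintype X] {ρ : X → ℝ} (hρ : ρ ∈ stdSimplex ℝ X) (n : ℕ) :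
    iid ρ n ∈ stdSimplex ℝ (Fin n → X) :=
  ⟨iid_nonneg hρ.1 n, by rw [sum_iid, hρ.2, one_pow]⟩

lemma successRate_iid {X : Type*} [Fintype X] {ρ : X → ℝ} (hρ : ρ ∈ stdSimplex ℝ X)
    {T : ∀ n : ℕ, (Fin n → X) → ℝ} (hT : ∀ n, IsTest (T n)) :
    successRate (fun n => {iid ρ n}) T
      = limsup (fun n => rate n (ENNReal.ofReal (∑ x, iid ρ n x * T n x))) atTop := by
  unfold successRate
  congr 1
  funext n
  rw [one_sub_typeIError_singleton (iid_mem_stdSimplex hρ n) (hT n)]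

/-! ### The converse bound -/

/-- Reduces the converse to a bound at each fixed `n` that turns a type II exponent `r'` into a
success exponent `s * r' - K`. The liminf condition only gives exponents `r - t` eventually, hence
the limit `t → 0`. -/
lemma le_successRate_iid {X : Type*} [Fintype X] {ρ σ : X → ℝ} (hρ : ρ ∈ stdSimplex ℝ X)
    {T : ∀ n : ℕ, (Fin n → X) → ℝ} (hT : ∀ n, IsTest (T n)) {r : ℝ}
    (hr : (r : EReal) ≤ typeIIRate (fun n => {iid σ n}) T) (s K : ℝ)
    (h : ∀ (n : ℕ) (r' : ℝ), ∑ x, iid σ n x * T n x ≤ Real.exp (-(n * r')) →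
      ∑ x, iid ρ n x * T n x ≤ Real.exp (-(n * (s * r' - K)))) :
    ((s * r - K : ℝ) : EReal) ≤ successRate (fun n => {iid ρ n}) T := by
  rw [successRate_iid hρ hT]
  have key : ∀ t : ℝ, 0 < t → ((s * (r - t) - K : ℝ) : EReal) ≤
      limsup (fun n => rate n (ENNReal.ofReal (∑ x, iid ρ n x * T n x))) atTop := by
    intro t ht
    have h1 : ((r - t : ℝ) : EReal) < typeIIRate (fun n => {iid σ n}) T :=
      lt_of_lt_of_le (by exact_mod_cast (by linarith)) hr
    have h2 := Filter.eventually_lt_of_lt_liminf h1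
    refine le_limsup_of_frequently_le (Eventually.frequently ?_)
    filter_upwards [h2, eventually_gt_atTop 0] with n hn hn0
    rw [typeIIError_singleton] at hn
    exact (le_rate_ofReal_iff hn0 _ _).2 (h n _ ((le_rate_ofReal_iff hn0 _ _).1 hn.le))
  have hlim : Tendsto (fun t : ℝ => ((s * (r - t) - K : ℝ) : EReal)) (nhdsWithin 0 (Set.Ioi 0))
      (nhds ((s * (r - 0) - K : ℝ) : EReal)) := by
    refine Tendsto.mono_left (Continuous.tendsto ?_ 0) nhdsWithin_le_nhds
    exact continuous_coe_real_ereal.comp (by fun_prop)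
  rw [sub_zero] at hlim
  refine le_of_tendsto hlim ?_
  filter_upwards [self_mem_nhdsWithin] with t ht using key t ht

/-- Hölder with exponents `α` and `1 / s`, where `s = (α - 1) / α`, applied to `a T = (a b^{-s})
(b^s T)`; then `T^{1/s} ≤ T` because `0 ≤ T ≤ 1`. -/
lemma sum_mul_test_le {Ω : Type*} [Fintype Ω] {a b T : Ω → ℝ} (ha : ∀ ω, 0 ≤ a ω)
    (hb : ∀ ω, 0 ≤ b ω) (hab : SuppLE a b) (hT : IsTest T) {α : ℝ} (hα : 1 < α) :
    ∑ ω, a ω * T ω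
      ≤ (∑ ω, a ω ^ α * b ω ^ (1 - α)) ^ (1 / α) * (∑ ω, b ω * T ω) ^ ((α - 1) / α) := by
  have hα0 : 0 < α := by linarith
  have hα1 : 0 < α - 1 := by linarith
  set s := (α - 1) / α with hs
  have hs0 : 0 < s := div_pos hα1 hα0
  have hsα : s * α = α - 1 := by rw [hs]; field_simp
  have hpq : α.HolderConjugate (1 / s) := by
    rw [Real.holderConjugate_iff]
    refine ⟨hα, ?_⟩
    rw [hs]; field_simp; ring
  have hH := Real.inner_le_Lp_mul_Lq Finset.univ (fun ω => a ω * b ω ^ (-s))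
    (fun ω => b ω ^ s * T ω) hpq
  have e1 : ∀ ω, a ω * b ω ^ (-s) * (b ω ^ s * T ω) = a ω * T ω := by
    intro ω
    rcases (hb ω).eq_or_lt with h | h
    · rw [hab ω h.symm]; simp
    · rw [Real.rpow_neg h.le]
      have := (Real.rpow_pos_of_pos h s).ne'
      field_simp
  have e2 : ∀ ω, |a ω * b ω ^ (-s)| ^ α = a ω ^ α * b ω ^ (1 - α) := by
    intro ω
    have hp := Real.rpow_nonneg (hb ω) (-s)
    rw [abs_of_nonneg (mul_nonneg (ha ω) hp), Real.mul_rpow (ha ω) hp, ← Real.rpow_mul (hb ω),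
      neg_mul, hsα, neg_sub]
  have e3 : ∀ ω, |b ω ^ s * T ω| ^ (1 / s) ≤ b ω * T ω := by
    intro ω
    have hp := Real.rpow_nonneg (hb ω) s
    rw [abs_of_nonneg (mul_nonneg hp (hT ω).1), Real.mul_rpow hp (hT ω).1, ← Real.rpow_mul (hb ω),
      mul_one_div_cancel hs0.ne', Real.rpow_one]
    refine mul_le_mul_of_nonneg_left ?_ (hb ω)
    refine Real.rpow_le_self_of_le_one (hT ω).1 (hT ω).2 ?_
    rw [le_div_iff₀ hs0, one_mul, hs, div_le_one hα0]
    linarith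
  simp only [e1, e2, one_div_one_div] at hH
  refine hH.trans (mul_le_mul_of_nonneg_left ?_ (Real.rpow_nonneg ?_ _))
  · exact Real.rpow_le_rpow (Finset.sum_nonneg fun ω _ => Real.rpow_nonneg (abs_nonneg _) _)
      (Finset.sum_le_sum fun ω _ => e3 ω) hs0.le
  · exact Finset.sum_nonneg fun ω _ =>
      mul_nonneg (Real.rpow_nonneg (ha ω) _) (Real.rpow_nonneg (hb ω) _)

lemma renyiSum_pos {X : Type*} [Fintype X] {ρ σ : X → ℝ} (hρ : ρ ∈ stdSimplex ℝ X)
    (hσ : σ ∈ stdSimplex ℝ X) (h : SuppLE ρ σ) (α : ℝ) : 0 < ∑ x, ρ x ^ α * σ x ^ (1 - α) := by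
  obtain ⟨x, -, hx⟩ := Finset.exists_ne_zero_of_sum_ne_zero (hρ.2.trans_ne one_ne_zero)
  refine Finset.sum_pos' (fun y _ => mul_nonneg (Real.rpow_nonneg (hρ.1 y) _)
    (Real.rpow_nonneg (hσ.1 y) _)) ⟨x, Finset.mem_univ x, ?_⟩
  exact mul_pos (Real.rpow_pos_of_pos ((hρ.1 x).lt_of_ne' hx) _)
    (Real.rpow_pos_of_pos ((hσ.1 x).lt_of_ne' fun h0 => hx (h x h0)) _)

lemma SuppLE.iid {X : Type*} {ρ σ : X → ℝ} (h : SuppLE ρ σ) (n : ℕ) :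
    SuppLE (iid ρ n) (iid σ n) := by
  intro x hx
  obtain ⟨k, hk, hk0⟩ := Finset.prod_eq_zero_iff.1 hx
  exact Finset.prod_eq_zero hk (h _ hk0)

/-- For `1 < α < ∞`, the quantity inside the supremum of the Hoeffding anti-divergence. -/
lemma hoeffding_term_of_suppLE {X : Type*} [Fintype X] {ρ σ : X → ℝ} (hρ : ρ ∈ stdSimplex ℝ X)
    (hσ : σ ∈ stdSimplex ℝ X) (h : SuppLE ρ σ) {α : ℝ} (hα : 1 < α) (r : ℝ) :
    (hoeffdingFactor (ENNReal.ofReal α) : EReal)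
        * ((r : EReal) - renyiDiv (ENNReal.ofReal α) ρ σ)
      = (((α - 1) / α * r - 1 / α * Real.log (∑ x, ρ x ^ α * σ x ^ (1 - α)) : ℝ) : EReal) := by
  have hα0 : 0 < α := by linarith
  have h1 : ENNReal.ofReal α ≠ 1 := by
    rw [← ENNReal.ofReal_one, Ne, ENNReal.ofReal_eq_ofReal_iff hα0.le zero_le_one]
    exact hα.ne'
  rw [renyiDiv, hoeffdingFactor, if_neg h1, if_neg ENNReal.ofReal_ne_top,
    if_neg ENNReal.ofReal_ne_top, ENNReal.toReal_ofReal hα0.le, renyiQ, if_pos h,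
    ENNReal.log_ofReal_of_pos (renyiSum_pos hρ hσ h α)]
  norm_cast
  have : α - 1 ≠ 0 := by linarith
  field_simp

theorem hoeffdingAnti_le_successRate {X : Type*} [Fintype X] {ρ σ : X → ℝ}
    (hρ : ρ ∈ stdSimplex ℝ X) (hσ : σ ∈ stdSimplex ℝ X)
    {T : ∀ n : ℕ, (Fin n → X) → ℝ} (hT : ∀ n, IsTest (T n)) {r : ℝ}
    (hr : (r : EReal) ≤ typeIIRate (fun n => {iid σ n}) T) :
    hoeffdingAnti r ρ σ ≤ successRate (fun n => {iid ρ n}) T := by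
  have hpos : (0 : EReal) ≤ successRate (fun n => {iid ρ n}) T := by
    have h := le_successRate_iid hρ hT hr 0 0 (fun n r' _ => by
      simp only [zero_mul, sub_zero, mul_zero, neg_zero, Real.exp_zero]
      rw [← (iid_mem_stdSimplex hρ n).2]
      exact Finset.sum_le_sum fun x _ =>
        mul_le_of_le_one_right ((iid_mem_stdSimplex hρ n).1 x) (hT n x).2)
    simpa using h
  refine iSup₂_le fun α hα => ?_
  rcases eq_or_ne α 1 with rfl | hα1
  · simpa [hoeffdingFactor] using hpos
  rcases eq_or_ne α ⊤ with rfl | hαt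
  · have key : ∀ l : ℝ, (∀ x, ρ x ≤ Real.exp l * σ x) →
        ((r - l : ℝ) : EReal) ≤ successRate (fun n => {iid ρ n}) T := by
      intro l hl
      have := le_successRate_iid hρ hT hr 1 l (fun n r' h => by
        have h1 : ∀ x, iid ρ n x ≤ Real.exp (n * l) * iid σ n x := by
          intro x
          calc iid ρ n x ≤ ∏ k, (Real.exp l * σ (x k)) :=
                Finset.prod_le_prod (fun _ _ => hρ.1 _) (fun _ _ => hl _)
            _ = Real.exp (n * l) * iid σ n x := by
                rw [Finset.prod_mul_distrib, Finset.prod_const, Finset.card_univ,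
                  Fintype.card_fin, ← Real.exp_nat_mul]; rfl
        calc ∑ x, iid ρ n x * T n x ≤ ∑ x, Real.exp (n * l) * (iid σ n x * T n x) :=
              Finset.sum_le_sum fun x _ => by
                rw [← mul_assoc]; exact mul_le_mul_of_nonneg_right (h1 x) (hT n x).1
          _ ≤ Real.exp (n * l) * Real.exp (-(n * r')) := by
              rw [← Finset.mul_sum]; exact mul_le_mul_of_nonneg_left h (Real.exp_pos _).le
          _ = Real.exp (-(n * (1 * r' - l))) := by rw [← Real.exp_add]; ring_nf)
      rwa [one_mul] at this
    have hf : hoeffdingFactor ⊤ = 1 := by simp [hoeffdingFactor]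
    have hd : renyiDiv ⊤ ρ σ = maxRelEntropy ρ σ := by simp [renyiDiv]
    rw [hf, hd, EReal.coe_one, one_mul]
    -- The bound for each feasible `l` passes to the infimum `maxRelEntropy`. For real `L` this also
    -- covers the case of no feasible `l`, where the infimum is `⊤`.
    generalize successRate (fun n => {iid ρ n}) T = L at key hpos
    induction L with
    | bot => simp at hpos
    | top => exact le_top
    | coe L =>
      refine EReal.sub_le_of_le_add ?_
      have h2 : ((r - L : ℝ) : EReal) ≤ maxRelEntropy ρ σ := le_iInf₂ fun l hl => by
        have := key l hl
        rw [EReal.coe_le_coe_iff] at this ⊢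
        linarith
      calc (r : EReal) = ((L + (r - L) : ℝ) : EReal) := by congr 1; ring
        _ = (L : EReal) + ((r - L : ℝ) : EReal) := EReal.coe_add _ _
        _ ≤ _ := by gcongr
  · lift α to NNReal using hαt
    have hα' : (1 : ℝ) < α := by
      have h1 : (1 : NNReal) ≤ α := by exact_mod_cast hα
      have h2 : (1 : NNReal) ≠ α := by rintro rfl; simp at hα1
      exact_mod_cast lt_of_le_of_ne h1 h2
    have hα0 : (0 : ℝ) < α := by linarith
    have hcoe : (α : ℝ≥0∞) = ENNReal.ofReal α := by simp
    by_cases hs : SuppLE ρ σ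
    · rw [hcoe, hoeffding_term_of_suppLE hρ hσ hs hα']
      set Q := ∑ x, ρ x ^ (α : ℝ) * σ x ^ (1 - (α : ℝ)) with hQ
      have hQ0 : 0 < Q := renyiSum_pos hρ hσ hs _
      refine le_successRate_iid hρ hT hr _ _ fun n r' h => ?_
      have h1 := sum_mul_test_le (iid_nonneg hρ.1 n) (iid_nonneg hσ.1 n) (hs.iid n) (hT n) hα'
      have h2 : ∑ x, iid ρ n x ^ (α : ℝ) * iid σ n x ^ (1 - (α : ℝ)) = Q ^ n := by
        rw [hQ, ← sum_iid]
        refine Finset.sum_congr rfl fun x _ => ?_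
        rw [iid, iid, iid, ← Real.finsetProd_rpow _ _ fun k _ => hρ.1 _,
          ← Real.finsetProd_rpow _ _ fun k _ => hσ.1 _, Finset.prod_mul_distrib]
      rw [h2] at h1
      have h3 : (∑ x, iid σ n x * T n x) ^ (((α : ℝ) - 1) / α)
          ≤ Real.exp (-(n * r')) ^ (((α : ℝ) - 1) / α) :=
        Real.rpow_le_rpow (Finset.sum_nonneg fun x _ =>
          mul_nonneg (iid_nonneg hσ.1 n x) (hT n x).1) h (div_nonneg (by linarith) hα0.le)
      refine (h1.trans (mul_le_mul_of_nonneg_left h3 (by positivity))).trans_eq ?_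
      rw [← Real.exp_mul, ← Real.rpow_natCast, ← Real.rpow_mul hQ0.le,
        Real.rpow_def_of_pos hQ0, ← Real.exp_add]
      congr 1
      ring
    · have h1 : renyiDiv (α : ℝ≥0∞) ρ σ = ⊤ := by
        rw [renyiDiv, if_neg hα1, if_neg ENNReal.coe_ne_top, renyiQ, if_neg hs, ENNReal.log_top,
          EReal.coe_mul_top_of_pos]
        simpa using hα'
      have h2 : 0 < hoeffdingFactor (α : ℝ≥0∞) := by
        rw [hoeffdingFactor, if_neg ENNReal.coe_ne_top]
        exact div_pos (by simpa using hα') (by simpa using hα0)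
      rw [h1, EReal.sub_top, EReal.coe_mul_bot_of_pos h2]
      exact bot_le

/-! ### Comparison of the alternative hypotheses -/

lemma typeIIError_mono {Ω : Type*} [Fintype Ω] {A B : Set (Ω → ℝ)} (h : A ⊆ B) (T : Ω → ℝ) :
    typeIIError A T ≤ typeIIError B T :=
  biSup_mono fun _ hσ => h hσ

lemma typeIIRate_anti {X : Type*} [Fintype X] {A B : ∀ n : ℕ, Set ((Fin n → X) → ℝ)}
    {T : ∀ n : ℕ, (Fin n → X) → ℝ} (h : ∀ n, typeIIError (A n) (T n) ≤ typeIIError (B n) (T n)) :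
    typeIIRate B T ≤ typeIIRate A T :=
  liminf_le_liminf (Eventually.of_forall fun n => rate_antitone n (h n))

/-- The hypothesis compares errors and not sets, so that it also applies to `S` and its closed
convex hull, where the inclusion goes the other way. -/
lemma scExponentRelaxed0_mono {X I : Type*} [Fintype X] (r : ℝ) (ρ : I → ∀ n : ℕ, (Fin n → X) → ℝ)
    {A B : ∀ n : ℕ, Set ((Fin n → X) → ℝ)}
    (h : ∀ n T, typeIIError (A n) T ≤ typeIIError (B n) T) :
    scExponentRelaxed0 r ρ A ≤ scExponentRelaxed0 r ρ B :=
  le_iInf fun T => le_iInf₂ fun hT hr =>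
    iInf_le_of_le T (iInf₂_le hT (hr.trans (typeIIRate_anti fun n => h n (T n))))

lemma compositeIID_subset_arbVarying {X : Type*} (S : Set (X → ℝ)) (n : ℕ) :
    compositeIID S n ⊆ arbVarying S n := by
  rintro _ ⟨σ, hσ, rfl⟩
  exact ⟨fun _ => σ, fun _ => hσ, rfl⟩

lemma arbVarying_subset_adversarial {X : Type*} (S : Set (X → ℝ)) (n : ℕ) :
    arbVarying S n ⊆ adversarial S n := by
  rintro _ ⟨σ, hσ, rfl⟩
  exact ⟨fun k _ => σ k, fun k _ => hσ k, rfl⟩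

lemma adversarial_mono {X : Type*} {A B : Set (X → ℝ)} (h : A ⊆ B) (n : ℕ) :
    adversarial A n ⊆ adversarial B n := by
  rintro _ ⟨q, hq, rfl⟩
  exact ⟨q, fun k y => h (hq k y), rfl⟩

lemma sum_prod_update {X : Type*} [Fintype X] {n : ℕ} (σ : Fin n → X → ℝ) (k : Fin n) (v : X → ℝ)
    (T : (Fin n → X) → ℝ) :
    ∑ x, (∏ j, Function.update σ k v j (x j)) * T x
      = ∑ x, v (x k) * ((∏ j ∈ Finset.univ.erase k, σ j (x j)) * T x) := by
  refine Finset.sum_congr rfl fun x _ => ?_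
  rw [← Finset.mul_prod_erase _ _ (Finset.mem_univ k), Function.update_self, mul_assoc]
  congr 2
  exact Finset.prod_congr rfl fun j hj => by rw [Function.update_of_ne (Finset.ne_of_mem_erase hj)]

lemma sum_prod_le_of_closure_convexHull {X : Type*} [Fintype X] {S : Set (X → ℝ)} {n : ℕ}
    {T : (Fin n → X) → ℝ} {b : ℝ}
    (h : ∀ σ : Fin n → X → ℝ, (∀ k, σ k ∈ S) → ∑ x, (∏ k, σ k (x k)) * T x ≤ b)
    (σ : Fin n → X → ℝ) (hσ : ∀ k, σ k ∈ closure (convexHull ℝ S)) :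
    ∑ x, (∏ k, σ k (x k)) * T x ≤ b := by
  -- Coordinates are released from `S` to the closed convex hull one at a time; `I` is the set of
  -- those already released. With the others fixed, the admissible values `A` of one factor form a
  -- closed convex set containing `S`.
  have main : ∀ I : Finset (Fin n), ∀ σ : Fin n → X → ℝ, (∀ k ∈ I, σ k ∈ closure (convexHull ℝ S)) →
      (∀ k ∉ I, σ k ∈ S) → ∑ x, (∏ k, σ k (x k)) * T x ≤ b := by
    intro I
    induction I using Finset.induction_on with
    | empty => exact fun σ _ h2 => h σ fun k => h2 k (Finset.notMem_empty k)
    | insert k I hk ih =>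
      intro σ h1 h2
      let A : Set (X → ℝ) := {v | ∑ x, (∏ j, Function.update σ k v j (x j)) * T x ≤ b}
      have hSA : S ⊆ A := by
        intro v hv
        refine ih _ (fun j hj => ?_) (fun j hj => ?_)
        · have : j ≠ k := fun e => hk (e ▸ hj)
          rw [Function.update_of_ne this]
          exact h1 j (Finset.mem_insert_of_mem hj)
        · rcases eq_or_ne j k with rfl | hjk
          · rwa [Function.update_self]
          · rw [Function.update_of_ne hjk]
            exact h2 j (by simp [hjk, hj])
      have hconv : Convex ℝ A := by
        intro v hv w hw a c ha hc hac
        simp only [A, Set.mem_ofPred_eq, sum_prod_update] at hv hw ⊢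
        calc _ = a * (∑ x, v (x k) * ((∏ j ∈ Finset.univ.erase k, σ j (x j)) * T x))
              + c * (∑ x, w (x k) * ((∏ j ∈ Finset.univ.erase k, σ j (x j)) * T x)) := by
              rw [Finset.mul_sum, Finset.mul_sum, ← Finset.sum_add_distrib]
              refine Finset.sum_congr rfl fun x _ => ?_
              simp only [Pi.add_apply, Pi.smul_apply, smul_eq_mul]
              ring
          _ ≤ a * b + c * b := by gcongr
          _ = b := by rw [← add_mul, hac, one_mul]
      have hclosed : IsClosed A := by
        simp only [A, sum_prod_update]
        exact isClosed_le (by fun_prop) continuous_const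
      have := closure_minimal (convexHull_min hSA hconv) hclosed (h1 k (Finset.mem_insert_self k I))
      simpa only [A, Set.mem_ofPred_eq, Function.update_eq_self] using this
  exact main Finset.univ σ (fun k _ => hσ k) (fun k hk => absurd (Finset.mem_univ k) hk)

lemma typeIIError_arbVarying_closure_convexHull {X : Type*} [Fintype X] (S : Set (X → ℝ)) (n : ℕ)
    (T : (Fin n → X) → ℝ) :
    typeIIError (arbVarying (closure (convexHull ℝ S)) n) T ≤ typeIIError (arbVarying S n) T := by
  rcases eq_or_ne (typeIIError (arbVarying S n) T) ⊤ with htop | htop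
  · rw [htop]; exact le_top
  refine iSup₂_le ?_
  rintro _ ⟨σ, hσ, rfl⟩
  rw [ENNReal.ofReal_le_iff_le_toReal htop]
  refine sum_prod_le_of_closure_convexHull (fun τ hτ => ?_) σ hσ
  rw [← ENNReal.ofReal_le_iff_le_toReal htop]
  exact le_iSup₂_of_le (f := fun p (_ : p ∈ arbVarying S n) => ENNReal.ofReal (∑ x, p x * T x))
    (fun x => ∏ k, τ k (x k)) ⟨τ, hτ, rfl⟩ le_rfl

/-! ### Exponential tilting and optimality conditions -/

/-- The Rényi sum `∑ ρ e^{u (log ρ - log σ)} = Q_{1+u}(ρ‖σ)`. -/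
noncomputable def tiltSum {X : Type*} [Fintype X] (ρ σ : X → ℝ) (u : ℝ) : ℝ :=
  ∑ x, ρ x * Real.exp (u * (Real.log (ρ x) - Real.log (σ x)))

/-- The tilted state, proportional to `ρ^{1+u} σ^{-u}`. -/
noncomputable def tilt {X : Type*} [Fintype X] (ρ σ : X → ℝ) (u : ℝ) : X → ℝ :=
  fun x => ρ x * Real.exp (u * (Real.log (ρ x) - Real.log (σ x))) / tiltSum ρ σ u

/-- The relative entropy of `τ` and `σ` for `supp τ ⊆ supp σ`. -/
noncomputable def klReal {X : Type*} [Fintype X] (τ σ : X → ℝ) : ℝ :=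
  ∑ x, τ x * (Real.log (τ x) - Real.log (σ x))

/-- The quantity `((α - 1) / α) (r - D_α(ρ‖σ))` at `α = 1 + u`. -/
noncomputable def hoeffdingValue {X : Type*} [Fintype X] (r : ℝ) (ρ σ : X → ℝ) (u : ℝ) : ℝ :=
  (u * r - Real.log (tiltSum ρ σ u)) / (1 + u)

section

variable {X : Type*} [Fintype X] {ρ σ : X → ℝ}

lemma exists_ne_zero_of_mem_stdSimplex (hρ : ρ ∈ stdSimplex ℝ X) : ∃ x, ρ x ≠ 0 := by
  obtain ⟨x, -, hx⟩ := Finset.exists_ne_zero_of_sum_ne_zero (hρ.2.trans_ne one_ne_zero)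
  exact ⟨x, hx⟩

lemma tiltSum_pos (hρ : ρ ∈ stdSimplex ℝ X) (σ : X → ℝ) (u : ℝ) : 0 < tiltSum ρ σ u := by
  obtain ⟨x, hx⟩ := exists_ne_zero_of_mem_stdSimplex hρ
  exact Finset.sum_pos' (fun y _ => mul_nonneg (hρ.1 y) (Real.exp_pos _).le)
    ⟨x, Finset.mem_univ x, mul_pos ((hρ.1 x).lt_of_ne' hx) (Real.exp_pos _)⟩

lemma tilt_mem_stdSimplex (hρ : ρ ∈ stdSimplex ℝ X) (σ : X → ℝ) (u : ℝ) :
    tilt ρ σ u ∈ stdSimplex ℝ X := by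
  refine ⟨fun x => div_nonneg (mul_nonneg (hρ.1 x) (Real.exp_pos _).le) (tiltSum_pos hρ σ u).le, ?_⟩
  simp only [tilt]
  rw [← Finset.sum_div]
  exact div_self (tiltSum_pos hρ σ u).ne'

lemma tilt_eq_zero {x : X} (hx : ρ x = 0) (u : ℝ) : tilt ρ σ u x = 0 := by
  simp [tilt, hx]

lemma log_tilt (hρ : ρ ∈ stdSimplex ℝ X) {x : X} (hx : ρ x ≠ 0) (σ : X → ℝ) (u : ℝ) :
    Real.log (tilt ρ σ u x) = Real.log (ρ x) + u * (Real.log (ρ x) - Real.log (σ x))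
      - Real.log (tiltSum ρ σ u) := by
  rw [tilt, Real.log_div (mul_ne_zero hx (Real.exp_pos _).ne') (tiltSum_pos hρ σ u).ne',
    Real.log_mul hx (Real.exp_pos _).ne', Real.log_exp]

/-- The mean of the log-likelihood ratio under the tilted state. -/
noncomputable def tiltMean {X : Type*} [Fintype X] (ρ σ : X → ℝ) (u : ℝ) : ℝ :=
  ∑ x, tilt ρ σ u x * (Real.log (ρ x) - Real.log (σ x))

/-- Together with `klReal_tilt_right`, this lets the mean be eliminated: `D(τ‖ρ)` is the Hoeffding
value plus `u (D(τ‖σ) - r) / (1 + u)`. -/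
lemma klReal_tilt_left (hρ : ρ ∈ stdSimplex ℝ X) (σ : X → ℝ) (u : ℝ) :
    klReal (tilt ρ σ u) ρ = u * tiltMean ρ σ u - Real.log (tiltSum ρ σ u) := by
  calc klReal (tilt ρ σ u) ρ
      = ∑ x, (u * (tilt ρ σ u x * (Real.log (ρ x) - Real.log (σ x)))
          - tilt ρ σ u x * Real.log (tiltSum ρ σ u)) := by
        refine Finset.sum_congr rfl fun x _ => ?_
        by_cases hx : ρ x = 0
        · simp [tilt_eq_zero hx]
        · rw [log_tilt hρ hx]; ring
    _ = _ := by
        rw [Finset.sum_sub_distrib, ← Finset.mul_sum, ← Finset.sum_mul,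
          (tilt_mem_stdSimplex hρ σ u).2, one_mul, tiltMean]

lemma klReal_tilt_right (hρ : ρ ∈ stdSimplex ℝ X) (σ : X → ℝ) (u : ℝ) :
    klReal (tilt ρ σ u) σ = (1 + u) * tiltMean ρ σ u - Real.log (tiltSum ρ σ u) := by
  calc klReal (tilt ρ σ u) σ
      = ∑ x, ((1 + u) * (tilt ρ σ u x * (Real.log (ρ x) - Real.log (σ x)))
          - tilt ρ σ u x * Real.log (tiltSum ρ σ u)) := by
        refine Finset.sum_congr rfl fun x _ => ?_
        by_cases hx : ρ x = 0
        · simp [tilt_eq_zero hx]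
        · rw [log_tilt hρ hx]; ring
    _ = _ := by
        rw [Finset.sum_sub_distrib, ← Finset.mul_sum, ← Finset.sum_mul,
          (tilt_mem_stdSimplex hρ σ u).2, one_mul, tiltMean]

lemma klReal_nonneg {τ : X → ℝ} (hτ : τ ∈ stdSimplex ℝ X) (hσ : σ ∈ stdSimplex ℝ X)
    (h : SuppLE τ σ) : 0 ≤ klReal τ σ := by
  have h1 : ∀ x, τ x - σ x ≤ τ x * (Real.log (τ x) - Real.log (σ x)) := by
    intro x
    by_cases hx : τ x = 0
    · simpa [hx] using hσ.1 x
    · have hτx := (hτ.1 x).lt_of_ne' hx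
      have hσx : 0 < σ x := (hσ.1 x).lt_of_ne' fun h0 => hx (h x h0)
      have h2 := Real.log_le_sub_one_of_pos (div_pos hσx hτx)
      rw [Real.log_div hσx.ne' hx] at h2
      have h3 := mul_le_mul_of_nonneg_left h2 hτx.le
      have h4 : τ x * (σ x / τ x - 1) = σ x - τ x := by field_simp
      linarith
  calc (0 : ℝ) = ∑ x, (τ x - σ x) := by rw [Finset.sum_sub_distrib, hτ.2, hσ.2, sub_self]
    _ ≤ klReal τ σ := Finset.sum_le_sum fun x _ => h1 x

lemma klReal_le_of_forall_le {τ : X → ℝ} (hτ : τ ∈ stdSimplex ℝ X) {κ : ℝ} (hκ : 0 < κ)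
    (h : ∀ x, τ x ≠ 0 → κ ≤ σ x) : klReal τ σ ≤ -Real.log κ := by
  calc klReal τ σ ≤ ∑ x, τ x * -Real.log κ := by
        refine Finset.sum_le_sum fun x _ => ?_
        by_cases hx : τ x = 0
        · simp [hx]
        · refine mul_le_mul_of_nonneg_left ?_ (hτ.1 x)
          have h1 : Real.log (τ x) ≤ 0 := Real.log_nonpos (hτ.1 x)
            (hτ.2 ▸ Finset.single_le_sum (fun y _ => hτ.1 y) (Finset.mem_univ x))
          have h2 := Real.log_le_log hκ (h x hx)
          linarith
    _ = -Real.log κ := by rw [← Finset.sum_mul, hτ.2, one_mul]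

lemma hasDerivAt_tiltSum (ρ σ : X → ℝ) (u : ℝ) :
    HasDerivAt (tiltSum ρ σ) (∑ x, ρ x * Real.exp (u * (Real.log (ρ x) - Real.log (σ x)))
      * (Real.log (ρ x) - Real.log (σ x))) u := by
  have h : ∀ x ∈ Finset.univ, HasDerivAt
      (fun u => ρ x * Real.exp (u * (Real.log (ρ x) - Real.log (σ x))))
      (ρ x * Real.exp (u * (Real.log (ρ x) - Real.log (σ x)))
        * (Real.log (ρ x) - Real.log (σ x))) u := by
    intro x _
    have h1 := ((hasDerivAt_id u).mul_const (Real.log (ρ x) - Real.log (σ x))).exp.const_mul (ρ x)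
    refine h1.congr_deriv ?_
    simp only [id]; ring
  exact HasDerivAt.fun_sum h

/-- The form of the derivative shows that an interior optimal `u` is one whose tilted state
satisfies `D(τ‖σ) = r`. -/
lemma hasDerivAt_hoeffdingValue (hρ : ρ ∈ stdSimplex ℝ X) (σ : X → ℝ) (r : ℝ) {u : ℝ}
    (hu : 0 < u) :
    HasDerivAt (hoeffdingValue r ρ σ) ((r - klReal (tilt ρ σ u) σ) / (1 + u) ^ 2) u := by
  have hQ := tiltSum_pos hρ σ u
  have h1 : HasDerivAt (fun u => Real.log (tiltSum ρ σ u)) (tiltMean ρ σ u) u := by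
    refine ((hasDerivAt_tiltSum ρ σ u).log hQ.ne').congr_deriv ?_
    rw [tiltMean, Finset.sum_div]
    exact Finset.sum_congr rfl fun x _ => by rw [tilt]; ring
  have h2 := (((hasDerivAt_id u).mul_const r).sub h1).div ((hasDerivAt_id u).const_add 1)
    (by simp only [id]; linarith)
  refine h2.congr_deriv ?_
  rw [klReal_tilt_right hρ]
  simp only [id, Pi.sub_apply]
  ring

end

lemma nonneg_of_hasDerivAt_of_right_min {g : ℝ → ℝ} {g' a b : ℝ} (hg : HasDerivAt g g' a)
    (hab : a < b) (h : ∀ t ∈ Set.Icc a b, g a ≤ g t) : 0 ≤ g' := by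
  have h1 := (hasDerivAt_iff_tendsto_slope.1 hg).mono_left
    (nhdsWithin_mono a (fun t (ht : t ∈ Set.Ioi a) => ne_of_gt ht))
  refine ge_of_tendsto h1 ?_
  filter_upwards [Ioo_mem_nhdsGT hab] with t ht
  rw [slope_def_field]
  exact div_nonneg (sub_nonneg.2 (h t ⟨ht.1.le, ht.2.le⟩)) (sub_nonneg.2 ht.1.le)

lemma nonpos_of_hasDerivAt_of_left_min {g : ℝ → ℝ} {g' a b : ℝ} (hg : HasDerivAt g g' b)
    (hab : a < b) (h : ∀ t ∈ Set.Icc a b, g b ≤ g t) : g' ≤ 0 := by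
  have h0 : HasDerivAt (fun t => g (-t)) (-g') (-b) := by
    have h1 : HasDerivAt g g' (- -b) := by rwa [neg_neg]
    exact (h1.comp (-b) (hasDerivAt_neg (-b))).congr_deriv (mul_neg_one g')
  have := nonneg_of_hasDerivAt_of_right_min h0 (neg_lt_neg hab) fun t ht => by
    rw [neg_neg]
    exact h (-t) ⟨by linarith [ht.2], by linarith [ht.1]⟩
  linarith

section

variable {X : Type*} [Fintype X] {ρ : X → ℝ}

/-- A minimiser of the Rényi sum over a convex set makes `τ / σ` an e-value, where `τ` is the
tilted state. -/
lemma sum_mul_tilt_div_le_one (hρ : ρ ∈ stdSimplex ℝ X) {K : Set (X → ℝ)} (hK : Convex ℝ K)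
    (hpos : ∀ σ ∈ K, ∀ x, ρ x ≠ 0 → 0 < σ x) {u : ℝ} (hu : 0 < u) {σ : X → ℝ} (hσ : σ ∈ K)
    (hmin : ∀ σ' ∈ K, tiltSum ρ σ u ≤ tiltSum ρ σ' u) {σ' : X → ℝ} (hσ' : σ' ∈ K) :
    ∑ x, σ' x * (tilt ρ σ u x / σ x) ≤ 1 := by
  have hQ := tiltSum_pos hρ σ u
  set w : X → ℝ := fun x => ρ x * Real.exp (u * (Real.log (ρ x) - Real.log (σ x))) with hw
  -- Along the segment from `σ` to `σ'` the Rényi sum `Q` has derivative `-u Q (σ'(τ/σ) - 1)` at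
  -- `σ`, which minimality forces to be nonnegative.
  have hd : HasDerivAt (fun t : ℝ => tiltSum ρ (fun x => σ x + t * (σ' x - σ x)) u)
      (∑ x, w x * (-u * ((σ' x - σ x) / σ x))) 0 := by
    refine HasDerivAt.fun_sum fun x _ => ?_
    by_cases hx : ρ x = 0
    · simpa [hw, hx] using hasDerivAt_const (0 : ℝ) (0 : ℝ)
    · have hσx := hpos σ hσ x hx
      have h1 : HasDerivAt (fun t : ℝ => σ x + t * (σ' x - σ x)) (σ' x - σ x) 0 := by
        simpa using ((hasDerivAt_id (0 : ℝ)).mul_const (σ' x - σ x)).const_add (σ x)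
      have h2 := (((h1.log (by simpa using hσx.ne')).const_sub (Real.log (ρ x))).const_mul
        u).exp.const_mul (ρ x)
      refine h2.congr_deriv ?_
      simp only [zero_mul, add_zero, hw]
      ring
  have h0 := nonneg_of_hasDerivAt_of_right_min hd zero_lt_one fun t ht => by
    have hmem : (fun x => σ x + t * (σ' x - σ x)) ∈ K := by
      have := hK hσ hσ' (sub_nonneg.2 ht.2) ht.1 (sub_add_cancel 1 t)
      convert this using 1
      funext x
      simp only [Pi.add_apply, Pi.smul_apply, smul_eq_mul]
      ring
    simpa using hmin _ hmem
  have h1 : ∑ x, w x * (-u * ((σ' x - σ x) / σ x))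
      = -u * (tiltSum ρ σ u * ∑ x, σ' x * (tilt ρ σ u x / σ x) - tiltSum ρ σ u) := by
    have : ∀ x, w x * (-u * ((σ' x - σ x) / σ x))
        = -u * (tiltSum ρ σ u * (σ' x * (tilt ρ σ u x / σ x)) - w x) := by
      intro x
      by_cases hx : ρ x = 0
      · simp [hw, tilt, hx]
      · have hσx := (hpos σ hσ x hx).ne'
        have hQ' := hQ.ne'
        simp only [tilt, hw]
        field_simp
    rw [Finset.sum_congr rfl fun x _ => this x, ← Finset.mul_sum, Finset.sum_sub_distrib,
      ← Finset.mul_sum]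
    rfl
  rw [h1] at h0
  by_contra! hlt
  have h3 : 0 < tiltSum ρ σ u * ∑ x, σ' x * (tilt ρ σ u x / σ x) - tiltSum ρ σ u := by
    nlinarith
  nlinarith

lemma continuousOn_hoeffdingValue (hρ : ρ ∈ stdSimplex ℝ X) (r : ℝ) {K : Set (X → ℝ)}
    (hpos : ∀ σ ∈ K, ∀ x, ρ x ≠ 0 → 0 < σ x) {a b : ℝ} (ha : 0 < a) :
    ContinuousOn (fun p : ℝ × (X → ℝ) => hoeffdingValue r ρ p.2 p.1) (Set.Icc a b ×ˢ K) := by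
  have h1 : ContinuousOn (fun p : ℝ × (X → ℝ) => tiltSum ρ p.2 p.1) (Set.Icc a b ×ˢ K) := by
    refine continuousOn_finsetSum _ fun x _ => ?_
    by_cases hx : ρ x = 0
    · simpa [hx] using continuousOn_const
    · have h2 : ContinuousOn (fun p : ℝ × (X → ℝ) => Real.log (p.2 x)) (Set.Icc a b ×ˢ K) :=
        ContinuousOn.log (by fun_prop) fun p hp => (hpos p.2 hp.2 x hx).ne'
      fun_prop
  have h3 : ContinuousOn (fun p : ℝ × (X → ℝ) => Real.log (tiltSum ρ p.2 p.1))
      (Set.Icc a b ×ˢ K) := h1.log fun p _ => (tiltSum_pos hρ p.2 p.1).ne'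
  refine ContinuousOn.div (by fun_prop) (by fun_prop) fun p hp => ?_
  have := hp.1.1
  linarith

/-- Approximate saddle point: the optimal order and alternative of the Hoeffding anti-divergence
yield a tilted state and an e-value. -/
theorem exists_approx_saddle (hρ : ρ ∈ stdSimplex ℝ X) {K : Set (X → ℝ)} (hK : Convex ℝ K)
    (hKc : IsCompact K) (hKne : K.Nonempty) (hKs : K ⊆ stdSimplex ℝ X) {κ : ℝ} (hκ : 0 < κ)
    (hlow : ∀ σ ∈ K, ∀ x, ρ x ≠ 0 → κ ≤ σ x) {r : ℝ} (hr : 0 < r) {η : ℝ} (hη : 0 < η) :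
    ∃ u > 0, ∃ σ ∈ K, (∀ σ' ∈ K, ∑ x, σ' x * (tilt ρ σ u x / σ x) ≤ 1) ∧
      klReal (tilt ρ σ u) ρ + max (r - klReal (tilt ρ σ u) σ) 0 ≤ hoeffdingValue r ρ σ u + η := by
  have hpos : ∀ σ ∈ K, ∀ x, ρ x ≠ 0 → 0 < σ x := fun σ hσ x hx => hκ.trans_le (hlow σ hσ x hx)
  -- The supremum over `u > 0` need not be attained, so `u` is confined to `[δ, M]`. If the
  -- maximiser is `u = δ`, the error is `u (D - r) / (1 + u) ≤ δ D ≤ δ (-log κ)`.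
  obtain ⟨δ, hδ, hδ1, hδη⟩ : ∃ δ : ℝ, 0 < δ ∧ δ < 1 ∧ δ * -Real.log κ ≤ η := by
    refine ⟨min (1 / 2) (η / (|Real.log κ| + 1)), lt_min (by norm_num) (by positivity),
      (min_le_left _ _).trans_lt (by norm_num), ?_⟩
    have h1 : min (1 / 2) (η / (|Real.log κ| + 1)) ≤ η / (|Real.log κ| + 1) := min_le_right _ _
    have h0 : (0 : ℝ) ≤ min (1 / 2) (η / (|Real.log κ| + 1)) := le_min (by norm_num) (by positivity)
    calc _ ≤ min (1 / 2) (η / (|Real.log κ| + 1)) * (|Real.log κ| + 1) :=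
          mul_le_mul_of_nonneg_left (by linarith [neg_abs_le (Real.log κ)]) h0
      _ ≤ η := by rwa [← le_div_iff₀ (by positivity)]
  -- If the maximiser is `u = M`, the error is `(r - D) / (1 + M) ≤ r / (1 + M)`, and `η (1 + M) = 2
  -- η + r`.
  set M : ℝ := 1 + r / η with hM
  have hM1 : 1 < M := by have := div_pos hr hη; linarith
  have hδM : δ < M := hδ1.trans hM1
  obtain ⟨⟨u, σ⟩, ⟨hu, hσ⟩, hmax⟩ := (isCompact_Icc.prod hKc).exists_isMaxOn
    ((Set.nonempty_Icc.2 hδM.le).prod hKne) (continuousOn_hoeffdingValue hρ r hpos (b := M) hδ)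
  have hu0 : 0 < u := hδ.trans_le hu.1
  have hmax' : ∀ v ∈ Set.Icc δ M, ∀ σ' ∈ K, hoeffdingValue r ρ σ' v ≤ hoeffdingValue r ρ σ u :=
    fun v hv σ' hσ' => hmax (show (v, σ') ∈ Set.Icc δ M ×ˢ K from ⟨hv, hσ'⟩)
  refine ⟨u, hu0, σ, hσ, fun σ' hσ' => ?_, ?_⟩
  · refine sum_mul_tilt_div_le_one hρ hK hpos hu0 hσ (fun σ'' hσ'' => ?_) hσ'
    have := hmax' u hu σ'' hσ''
    rw [hoeffdingValue, hoeffdingValue, div_le_div_iff_of_pos_right (by linarith)] at this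
    exact (Real.log_le_log_iff (tiltSum_pos hρ _ _) (tiltSum_pos hρ _ _)).1 (by linarith)
  · set τ := tilt ρ σ u with hτ
    have hτs := tilt_mem_stdSimplex hρ σ u
    have hτ0 : ∀ x, τ x ≠ 0 → ρ x ≠ 0 := fun x hx h0 => hx (tilt_eq_zero h0 u)
    set D := klReal τ σ with hD
    have hD0 : 0 ≤ D := klReal_nonneg hτs (hKs hσ) fun x hx => by
      by_contra h
      exact (hpos σ hσ x (hτ0 x h)).ne' hx
    have hDκ : D ≤ -Real.log κ :=
      klReal_le_of_forall_le hτs hκ fun x hx => hlow σ hσ x (hτ0 x hx)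
    have hder := (hasDerivAt_hoeffdingValue hρ σ r hu0).neg
    have hsq : 0 < (1 + u) ^ 2 := by positivity
    have hleft : δ < u → D ≤ r := fun h => by
      have := nonpos_of_hasDerivAt_of_left_min hder h fun t ht =>
        neg_le_neg (hmax' t ⟨ht.1, ht.2.trans hu.2⟩ σ hσ)
      rw [neg_nonpos, le_div_iff₀ hsq, zero_mul] at this
      linarith
    have hright : u < M → r ≤ D := fun h => by
      have := nonneg_of_hasDerivAt_of_right_min hder h fun t ht =>
        neg_le_neg (hmax' t ⟨hu.1.trans ht.1, ht.2⟩ σ hσ)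
      rw [neg_nonneg, div_le_iff₀ hsq, zero_mul] at this
      linarith
    have hkl : klReal τ ρ = hoeffdingValue r ρ σ u + u * (D - r) / (1 + u) := by
      rw [hD, hτ, klReal_tilt_left hρ, klReal_tilt_right hρ, hoeffdingValue]
      field_simp
      ring
    rw [hkl, add_assoc]
    refine add_le_add le_rfl ?_
    have hu1 : 0 < 1 + u := by linarith
    rcases le_total r D with h | h
    · rw [max_eq_right (by linarith), add_zero, div_le_iff₀ hu1]
      rcases hu.1.eq_or_lt with rfl | h'
      · nlinarith
      · rw [le_antisymm (hleft h') h]; simp; positivity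
    · rw [max_eq_left (by linarith)]
      rcases hu.2.eq_or_lt with h' | h'
      · have e : u * (D - r) / (1 + u) + (r - D) = (r - D) / (1 + u) := by field_simp; ring
        rw [e, div_le_iff₀ hu1]
        have : η * (1 + u) = 2 * η + r := by
          rw [show u = M from h', hM]; field_simp; ring
        linarith
      · rw [le_antisymm h (hright h')]; simpa using hη.le

end

/-! ### Mixture tests from e-values -/

/-- Nonnegative functions with expectation at most one under every state of `C`. -/
def eValues {X : Type*} [Fintype X] (C : Set (X → ℝ)) : Set (X → ℝ) :=
  {E | (∀ x, 0 ≤ E x) ∧ ∀ σ ∈ C, ∑ x, σ x * E x ≤ 1}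

lemma zero_mem_eValues {X : Type*} [Fintype X] (C : Set (X → ℝ)) : 0 ∈ eValues C :=
  ⟨fun _ => le_rfl, fun _ _ => by simp⟩

/-- Products of e-values are e-values against adversarial alternatives. -/
lemma sum_adversarial_mul_prod_le_one {X : Type*} [Fintype X] {C : Set (X → ℝ)}
    (hC : ∀ σ ∈ C, ∀ x, 0 ≤ σ x) {E : X → ℝ} (hE : E ∈ eValues C) {n : ℕ}
    {p : (Fin n → X) → ℝ} (hp : p ∈ adversarial C n) : ∑ x, p x * ∏ k, E (x k) ≤ 1 := by
  obtain ⟨q, hq, rfl⟩ := hp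
  induction n with
  | zero => simp
  | succ n ih =>
    -- The last coordinate is summed first: given the past `y`, its law lies in `C`, so the last
    -- factor has conditional expectation at most one.
    rw [← (Fin.snocEquiv fun _ => X).sum_comp, Fintype.sum_prod_type_right]
    calc _ = ∑ y : Fin n → X, ((∏ k : Fin n,
            q k.castSucc (fun j => y (Fin.castLE k.isLt.le j)) (y k)) * ∏ k, E (y k)) *
              ∑ a, q (Fin.last n) y a * E a := by
          refine Finset.sum_congr rfl fun y _ => ?_
          rw [Finset.mul_sum]
          refine Finset.sum_congr rfl fun a _ => ?_
          beta_reduce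
          rw [Fin.prod_univ_castSucc, Fin.prod_univ_castSucc]
          have h1 : ∀ (k : Fin n) (j : Fin k), (Fin.snoc (α := fun _ => X) y a : Fin (n + 1) → X)
              (Fin.castLE (Fin.castSucc k).isLt.le j) = y (Fin.castLE k.isLt.le j) := fun k j =>
            Fin.snoc_castSucc (α := fun _ => X) a y (Fin.castLE k.isLt.le j)
          have h2 : (fun j : Fin n => (Fin.snoc (α := fun _ => X) y a : Fin (n + 1) → X)
              (Fin.castLE (Fin.last n).isLt.le j)) = y := by
            funext j
            exact Fin.snoc_castSucc (α := fun _ => X) a y j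
          simp only [Fin.snocEquiv, Equiv.coe_fn_mk, Fin.snoc_castSucc, Fin.snoc_last]
          have h3 : ∀ k : Fin n, q k.castSucc (fun j => (Fin.snoc (α := fun _ => X) y a :
              Fin (n + 1) → X) (Fin.castLE (Fin.castSucc k).isLt.le j)) (y k)
              = q k.castSucc (fun j => y (Fin.castLE k.isLt.le j)) (y k) := fun k =>
            congrArg (fun z => q k.castSucc z (y k)) (funext (h1 k))
          have h4 : q (Fin.last n) (fun j => (Fin.snoc (α := fun _ => X) y a :
              Fin (n + 1) → X) (Fin.castLE (Fin.last n).isLt.le j)) a = q (Fin.last n) y a :=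
            congrArg (fun z => q (Fin.last n) z a) h2
          rw [Finset.prod_congr rfl fun k _ => h3 k, h4]
          ring
      _ ≤ ∑ y : Fin n → X, ((∏ k : Fin n,
            q k.castSucc (fun j => y (Fin.castLE k.isLt.le j)) (y k)) * ∏ k, E (y k)) * 1 := by
          refine Finset.sum_le_sum fun y _ => mul_le_mul_of_nonneg_left (hE.2 _ (hq _ _)) ?_
          exact mul_nonneg (Finset.prod_nonneg fun k _ => hC _ (hq _ _) _)
            (Finset.prod_nonneg fun k _ => hE.1 _)
      _ ≤ 1 := by
          simp only [mul_one]
          exact ih (fun k => q k.castSucc) fun k y => hq _ _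

/-- The test thresholding the uniform mixture of the first `n` e-values of a sequence. -/
noncomputable def mixtureTest {X : Type*} (r : ℝ) (E : ℕ → X → ℝ) (n : ℕ) (x : Fin n → X) : ℝ :=
  min 1 (Real.exp (-(n * r)) * ∑ j ∈ Finset.range n, 1 / (n : ℝ) * ∏ k, E j (x k))

lemma isTest_mixtureTest {X : Type*} (r : ℝ) {E : ℕ → X → ℝ} (hE : ∀ j x, 0 ≤ E j x) (n : ℕ) :
    IsTest (mixtureTest r E n) := fun x =>
  ⟨le_min zero_le_one (mul_nonneg (Real.exp_pos _).le (Finset.sum_nonneg fun j _ =>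
    mul_nonneg (by positivity) (Finset.prod_nonneg fun k _ => hE j _))), min_le_left _ _⟩

/-- Retaining a single e-value costs the factor `1 / n`, which is invisible in the exponent, and
each `j` enters the mixture once `n > j`. -/
lemma le_mixtureTest {X : Type*} (r : ℝ) {E : ℕ → X → ℝ} (hE : ∀ j x, 0 ≤ E j x) {n j : ℕ}
    (hj : j < n) (x : Fin n → X) :
    min 1 (Real.exp (-(n * r)) * (1 / (n : ℝ) * ∏ k, E j (x k))) ≤ mixtureTest r E n x := by
  refine min_le_min le_rfl (mul_le_mul_of_nonneg_left ?_ (Real.exp_pos _).le)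
  exact Finset.single_le_sum (f := fun j => 1 / (n : ℝ) * ∏ k, E j (x k))
    (fun i _ => mul_nonneg (by positivity) (Finset.prod_nonneg fun k _ => hE i _))
    (Finset.mem_range.2 hj)

lemma sum_adversarial_mul_mixtureTest_le {X : Type*} [Fintype X] {C : Set (X → ℝ)}
    (hC : ∀ σ ∈ C, ∀ x, 0 ≤ σ x) (r : ℝ) {E : ℕ → X → ℝ} (hE : ∀ j, E j ∈ eValues C) {n : ℕ}
    (hn : 0 < n) {p : (Fin n → X) → ℝ} (hp : p ∈ adversarial C n) :
    ∑ x, p x * mixtureTest r E n x ≤ Real.exp (-(n * r)) := by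
  have hp0 : ∀ x, 0 ≤ p x := by
    obtain ⟨q, hq, rfl⟩ := hp
    exact fun x => Finset.prod_nonneg fun k _ => hC _ (hq _ _) _
  have hn' : (n : ℝ) ≠ 0 := by exact_mod_cast hn.ne'
  calc ∑ x, p x * mixtureTest r E n x
      ≤ ∑ x, p x * (Real.exp (-(n * r)) * ∑ j ∈ Finset.range n, 1 / (n : ℝ) * ∏ k, E j (x k)) :=
        Finset.sum_le_sum fun x _ => mul_le_mul_of_nonneg_left (min_le_right _ _) (hp0 x)
    _ = Real.exp (-(n * r)) * ∑ j ∈ Finset.range n, 1 / (n : ℝ) * ∑ x, p x * ∏ k, E j (x k) := by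
        simp only [Finset.mul_sum]
        rw [Finset.sum_comm]
        exact Finset.sum_congr rfl fun j _ => Finset.sum_congr rfl fun x _ => by ring
    _ ≤ Real.exp (-(n * r)) * ∑ j ∈ Finset.range n, 1 / (n : ℝ) * 1 := by
        gcongr with j _
        exact sum_adversarial_mul_prod_le_one hC (hE j) hp
    _ = Real.exp (-(n * r)) := by simp [hn']

lemma le_typeIIRate_mixtureTest {X : Type*} [Fintype X] {C : Set (X → ℝ)}
    (hC : ∀ σ ∈ C, ∀ x, 0 ≤ σ x) (r : ℝ) {E : ℕ → X → ℝ} (hE : ∀ j, E j ∈ eValues C) :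
    (r : EReal) ≤ typeIIRate (adversarial C) (mixtureTest r E) := by
  refine le_liminf_of_le (h := ?_)
  filter_upwards [eventually_gt_atTop 0] with n hn
  refine le_trans ((le_rate_ofReal_iff hn (Real.exp (-(n * r))) r).2 le_rfl) (rate_antitone n ?_)
  exact iSup₂_le fun p hp =>
    ENNReal.ofReal_le_ofReal (sum_adversarial_mul_mixtureTest_le hC r hE hn hp)

/-! ### A weak law of large numbers for product states -/

lemma prod_eq_exp_sum_log {X : Type*} {n : ℕ} {f : X → ℝ} {x : Fin n → X} (h : ∀ k, 0 < f (x k)) :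
    ∏ k, f (x k) = Real.exp (∑ k, Real.log (f (x k))) := by
  rw [Real.exp_sum]
  exact Finset.prod_congr rfl fun k _ => (Real.exp_log (h k)).symm

section

variable {X : Type*} [Fintype X] {τ : X → ℝ}

lemma sum_iid_succ (τ : X → ℝ) (n : ℕ) (F : (Fin (n + 1) → X) → ℝ) :
    ∑ x, iid τ (n + 1) x * F x
      = ∑ a, τ a * ∑ y, iid τ n y * F (Fin.cons a y) := by
  rw [← (Fin.consEquiv fun _ => X).sum_comp, Fintype.sum_prod_type]
  refine Finset.sum_congr rfl fun a _ => ?_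
  rw [Finset.mul_sum]
  refine Finset.sum_congr rfl fun y _ => ?_
  simp only [iid, Fin.consEquiv, Equiv.coe_fn_mk, Fin.prod_univ_succ, Fin.cons_zero, Fin.cons_succ]
  ring

lemma sum_iid_mul_sum (hτ : ∑ x, τ x = 1) {g : X → ℝ} (hg : ∑ x, τ x * g x = 0) (n : ℕ) :
    ∑ x, iid τ n x * ∑ k, g (x k) = 0 := by
  induction n with
  | zero => simp
  | succ n ih =>
    rw [sum_iid_succ]
    simp only [Fin.sum_univ_succ, Fin.cons_zero, Fin.cons_succ, mul_add, Finset.sum_add_distrib,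
      ih, add_zero]
    simp only [← Finset.sum_mul, sum_iid, hτ, one_pow, one_mul, hg]

lemma sum_iid_mul_sum_sq (hτ : ∑ x, τ x = 1) {g : X → ℝ} (hg : ∑ x, τ x * g x = 0) (n : ℕ) :
    ∑ x, iid τ n x * (∑ k, g (x k)) ^ 2 = n * ∑ x, τ x * g x ^ 2 := by
  induction n with
  | zero => simp
  | succ n ih =>
    rw [sum_iid_succ]
    have h1 : ∀ a, ∑ y, iid τ n y * (∑ k, g ((Fin.cons a y : Fin (n + 1) → X) k)) ^ 2
        = g a ^ 2 + n * ∑ x, τ x * g x ^ 2 := by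
      intro a
      have h2 : ∀ y : Fin n → X, iid τ n y * (∑ k, g ((Fin.cons a y : Fin (n + 1) → X) k)) ^ 2
          = iid τ n y * g a ^ 2 + 2 * g a * (iid τ n y * ∑ k, g (y k))
            + iid τ n y * (∑ k, g (y k)) ^ 2 := by
        intro y
        simp only [Fin.sum_univ_succ, Fin.cons_zero, Fin.cons_succ]
        ring
      rw [Finset.sum_congr rfl fun y _ => h2 y, Finset.sum_add_distrib, Finset.sum_add_distrib, ih,
        ← Finset.mul_sum, sum_iid_mul_sum hτ hg, ← Finset.sum_mul, sum_iid, hτ]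
      ring
    simp only [h1, mul_add, Finset.sum_add_distrib]
    rw [← Finset.sum_mul, hτ]
    push_cast
    ring

open Classical in
-- Chebyshev's inequality, the variance of the sum being `n V`. The constant `1 / 4` lets two such
-- events be discarded with half of the mass left.
lemma eventually_sum_iid_deviation_le (hτ : τ ∈ stdSimplex ℝ X) (g : X → ℝ) {ζ : ℝ} (hζ : 0 < ζ) :
    ∀ᶠ n : ℕ in atTop, ∑ x, iid τ n x *
      (if n * ζ < |∑ k, g (x k) - n * ∑ a, τ a * g a| then 1 else 0) ≤ 1 / 4 := by
  set m := ∑ a, τ a * g a with hm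
  set V := ∑ a, τ a * (g a - m) ^ 2 with hV
  have hc : ∑ a, τ a * (g a - m) = 0 := by
    simp only [mul_sub, Finset.sum_sub_distrib, ← Finset.sum_mul, hτ.2, one_mul, ← hm, sub_self]
  obtain ⟨N, hN⟩ := exists_nat_ge (4 * V / ζ ^ 2)
  filter_upwards [eventually_ge_atTop N, eventually_gt_atTop 0] with n hnN hn
  have hn' : (0 : ℝ) < n := by exact_mod_cast hn
  have hnζ : 0 < n * ζ := by positivity
  have h1 : ∀ x : Fin n → X,
      (if n * ζ < |∑ k, g (x k) - n * m| then (1 : ℝ) else 0)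
        ≤ (∑ k, (g (x k) - m)) ^ 2 / (n * ζ) ^ 2 := by
    intro x
    have e : ∑ k, (g (x k) - m) = ∑ k, g (x k) - n * m := by
      simp [Finset.sum_sub_distrib]
    rw [e]
    split_ifs with h
    · rw [le_div_iff₀ (by positivity), one_mul, ← sq_abs (_ - _)]
      exact pow_le_pow_left₀ hnζ.le h.le 2
    · positivity
  calc _ ≤ ∑ x, iid τ n x * ((∑ k, (g (x k) - m)) ^ 2 / (n * ζ) ^ 2) :=
        Finset.sum_le_sum fun x _ => mul_le_mul_of_nonneg_left (h1 x) (iid_nonneg hτ.1 n x)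
    _ = n * V / (n * ζ) ^ 2 := by
        simp only [← mul_div_assoc]
        rw [← Finset.sum_div, sum_iid_mul_sum_sq hτ.2 (g := fun a => g a - m) hc]
    _ ≤ 1 / 4 := by
        have h2 : 4 * V / ζ ^ 2 ≤ n := hN.trans (by exact_mod_cast hnN)
        rw [div_le_iff₀ (by positivity)] at h2 ⊢
        nlinarith

/-! ### Success rate of mixture tests -/

open Classical in
-- Change of measure: on sequences typical for `τ`, the ratio of `ρ^n` to `τ^n` is about `e^{-n
-- D(τ‖ρ)}` and the test is at least about `e^{-n (r - τ(log F))⁺} / n`.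
lemma limsup_rate_le {ρ F : X → ℝ} {T : ∀ n : ℕ, (Fin n → X) → ℝ} {r : ℝ}
    (hρ : ∀ x, 0 ≤ ρ x) (hτ : τ ∈ stdSimplex ℝ X) (hτρ : ∀ x, τ x ≠ 0 → 0 < ρ x)
    (hτF : ∀ x, τ x ≠ 0 → 0 < F x) (hT0 : ∀ n x, 0 ≤ T n x)
    (hT : ∀ᶠ n : ℕ in atTop, ∀ x,
      min 1 (Real.exp (-(n * r)) * (1 / (n : ℝ) * ∏ k, F (x k))) ≤ T n x) :
    limsup (fun n => rate n (ENNReal.ofReal (∑ x, iid ρ n x * T n x))) atTop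
      ≤ ((klReal τ ρ + max (r - ∑ x, τ x * Real.log (F x)) 0 : ℝ) : EReal) := by
  set m₁ := klReal τ ρ with hm₁
  set m₂ := ∑ x, τ x * Real.log (F x) with hm₂
  set c := max (r - m₂) 0 with hc
  have key : ∀ ζ : ℝ, 0 < ζ →
      limsup (fun n => rate n (ENNReal.ofReal (∑ x, iid ρ n x * T n x))) atTop
        ≤ ((m₁ + c + 3 * ζ : ℝ) : EReal) := by
    intro ζ hζ
    refine limsup_le_of_le (h := ?_)
    obtain ⟨N, hN⟩ := exists_nat_ge (4 / ζ ^ 2)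
    filter_upwards [hT, eventually_gt_atTop 0, eventually_ge_atTop N,
      eventually_sum_iid_deviation_le hτ (fun x => Real.log (τ x) - Real.log (ρ x)) hζ,
      eventually_sum_iid_deviation_le hτ (fun x => Real.log (F x)) hζ] with n hTn hn hnN h₁ h₂
    have hn' : (0 : ℝ) < n := by exact_mod_cast hn
    have hn1 : (1 : ℝ) ≤ n := by exact_mod_cast hn
    refine rate_ofReal_le hn ?_
    set A : ℝ := 1 / n * Real.exp (-(n * (m₁ + c + 2 * ζ))) with hA
    have hA0 : 0 < A := by positivity
    -- Two of the three `ζ` pay for the two typicality windows; the third absorbs the factor `1 / (2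
    -- n)`, since `e^{nζ} ≥ (nζ)² / 2 ≥ 2 n`.
    have hexp : Real.exp (-(n * (m₁ + c + 3 * ζ))) ≤ 1 / 2 * A := by
      have h3 : 4 / ζ ^ 2 ≤ n := hN.trans (by exact_mod_cast hnN)
      rw [div_le_iff₀ (by positivity)] at h3
      have h4 := Real.quadratic_le_exp_of_nonneg (x := n * ζ) (by positivity)
      have h5 : 2 * n ≤ Real.exp (n * ζ) := by nlinarith [mul_pos hn' hζ]
      have h6 : Real.exp (-(n * (m₁ + c + 2 * ζ)))
          = Real.exp (-(n * (m₁ + c + 3 * ζ))) * Real.exp (n * ζ) := by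
        rw [← Real.exp_add]; ring_nf
      have h7 : 1 / 2 * A = Real.exp (-(n * (m₁ + c + 3 * ζ))) * (Real.exp (n * ζ) / (2 * n)) := by
        rw [hA, h6]; field_simp
      rw [h7]
      refine le_mul_of_one_le_right (Real.exp_pos _).le ?_
      rwa [le_div_iff₀ (by positivity), one_mul]
    refine hexp.trans ?_
    set b₁ : (Fin n → X) → ℝ := fun x => if n * ζ < |∑ k, (Real.log (τ (x k)) - Real.log (ρ (x k)))
      - n * ∑ a, τ a * (Real.log (τ a) - Real.log (ρ a))| then 1 else 0 with hb₁
    set b₂ : (Fin n → X) → ℝ := fun x => if n * ζ < |∑ k, Real.log (F (x k))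
      - n * ∑ a, τ a * Real.log (F a)| then 1 else 0 with hb₂
    -- `1 - b₁ - b₂` bounds the indicator of the typical set from below and is nonpositive off it,
    -- so only typical sequences need an estimate.
    have hpt : ∀ x, iid τ n x * (1 - b₁ x - b₂ x) * A ≤ iid ρ n x * T n x := by
      intro x
      have hr0 : 0 ≤ iid ρ n x * T n x := mul_nonneg (iid_nonneg hρ n x) (hT0 n x)
      have ht0 := iid_nonneg hτ.1 n x
      by_cases hx : ∀ k, τ (x k) ≠ 0
      swap
      · push Not at hx
        obtain ⟨k, hk⟩ := hx
        have : iid τ n x = 0 := Finset.prod_eq_zero (Finset.mem_univ k) hk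
        simpa [this] using hr0
      by_cases hg₁ : n * ζ < |∑ k, (Real.log (τ (x k)) - Real.log (ρ (x k)))
          - n * ∑ a, τ a * (Real.log (τ a) - Real.log (ρ a))|
      · have : 0 ≤ b₂ x := by simp only [hb₂]; positivity
        have h8 : 1 - b₁ x - b₂ x ≤ 0 := by simp only [hb₁, if_pos hg₁]; linarith
        exact (mul_nonpos_of_nonpos_of_nonneg (mul_nonpos_of_nonneg_of_nonpos ht0 h8) hA0.le).trans
          hr0
      by_cases hg₂ : n * ζ < |∑ k, Real.log (F (x k)) - n * ∑ a, τ a * Real.log (F a)|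
      · have : 0 ≤ b₁ x := by simp only [hb₁]; positivity
        have h8 : 1 - b₁ x - b₂ x ≤ 0 := by simp only [hb₂, if_pos hg₂]; linarith
        exact (mul_nonpos_of_nonpos_of_nonneg (mul_nonpos_of_nonneg_of_nonpos ht0 h8) hA0.le).trans
          hr0
      simp only [hb₁, hb₂, if_neg hg₁, if_neg hg₂, sub_zero, mul_one]
      have hs₁ := (abs_le.1 (not_lt.1 hg₁)).2
      have hs₂ := (abs_le.1 (not_lt.1 hg₂)).1
      change _ - n * m₁ ≤ _ at hs₁
      rw [← hm₂] at hs₂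
      have hρx : iid ρ n x
          = iid τ n x * Real.exp (-∑ k, (Real.log (τ (x k)) - Real.log (ρ (x k)))) := by
        rw [iid, iid, prod_eq_exp_sum_log fun k => hτρ _ (hx k),
          prod_eq_exp_sum_log fun k => (hτ.1 _).lt_of_ne' (hx k), ← Real.exp_add,
          Finset.sum_sub_distrib]
        congr 1
        ring
      have hTx : 1 / n * Real.exp (-(n * (c + ζ))) ≤ T n x := by
        refine le_trans (le_min ?_ ?_) (hTn x)
        · have h9 : Real.exp (-(n * (c + ζ))) ≤ 1 := by
            rw [Real.exp_le_one_iff, neg_nonpos]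
            exact mul_nonneg hn'.le (add_nonneg (le_max_right _ _) hζ.le)
          have h10 : 1 / (n : ℝ) ≤ 1 := by rwa [div_le_one hn']
          exact mul_le_one₀ h10 (Real.exp_pos _).le h9
        · rw [prod_eq_exp_sum_log fun k => hτF _ (hx k), mul_left_comm, ← Real.exp_add]
          refine mul_le_mul_of_nonneg_left (Real.exp_le_exp.2 ?_) (by positivity)
          have := mul_le_mul_of_nonneg_left (le_max_left (r - m₂) 0) hn'.le
          rw [← hc] at this
          linarith
      rw [hρx, mul_assoc]
      refine mul_le_mul_of_nonneg_left ?_ ht0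
      calc A = Real.exp (-(n * (m₁ + ζ))) * (1 / n * Real.exp (-(n * (c + ζ)))) := by
            rw [hA, mul_left_comm, ← Real.exp_add]; ring_nf
        _ ≤ _ := mul_le_mul (Real.exp_le_exp.2 (by linarith)) hTx (by positivity)
            (Real.exp_pos _).le
    calc 1 / 2 * A ≤ (∑ x, iid τ n x * (1 - b₁ x - b₂ x)) * A := by
          refine mul_le_mul_of_nonneg_right ?_ hA0.le
          simp only [mul_sub, Finset.sum_sub_distrib, mul_one, sum_iid, hτ.2, one_pow]
          linarith
      _ ≤ ∑ x, iid ρ n x * T n x := by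
          rw [Finset.sum_mul]
          exact Finset.sum_le_sum fun x _ => hpt x
  have hlim : Tendsto (fun ζ : ℝ => ((m₁ + c + 3 * ζ : ℝ) : EReal)) (nhdsWithin 0 (Set.Ioi 0))
      (nhds ((m₁ + c + 3 * 0 : ℝ) : EReal)) :=
    Tendsto.mono_left (Continuous.tendsto (continuous_coe_real_ereal.comp (by fun_prop)) 0)
      nhdsWithin_le_nhds
  rw [mul_zero, add_zero] at hlim
  refine ge_of_tendsto hlim ?_
  filter_upwards [self_mem_nhdsWithin] with ζ hζ using key ζ hζ

end

/-! ### Achievability -/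

lemma hoeffdingValue_le_hoeffdingAnti {X : Type*} [Fintype X] {ρ σ : X → ℝ}
    (hρ : ρ ∈ stdSimplex ℝ X) (hσ : σ ∈ stdSimplex ℝ X) (h : SuppLE ρ σ) (r : ℝ) {u : ℝ}
    (hu : 0 < u) : (hoeffdingValue r ρ σ u : EReal) ≤ hoeffdingAnti r ρ σ := by
  have h1 : ∑ x, ρ x ^ (1 + u) * σ x ^ (1 - (1 + u)) = tiltSum ρ σ u := by
    refine Finset.sum_congr rfl fun x _ => ?_
    by_cases hx : ρ x = 0
    · simp [hx, Real.zero_rpow (by linarith : 1 + u ≠ 0)]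
    · have hρx := (hρ.1 x).lt_of_ne' hx
      have hσx : 0 < σ x := (hσ.1 x).lt_of_ne' fun h0 => hx (h x h0)
      rw [Real.rpow_add hρx, Real.rpow_one, mul_assoc, Real.rpow_def_of_pos hρx,
        Real.rpow_def_of_pos hσx, ← Real.exp_add]
      ring_nf
  have h2 := hoeffding_term_of_suppLE hρ hσ h (show 1 < 1 + u by linarith) r
  rw [h1] at h2
  have h3 : (1 + u - 1) / (1 + u) * r - 1 / (1 + u) * Real.log (tiltSum ρ σ u)
      = hoeffdingValue r ρ σ u := by
    rw [hoeffdingValue]; ring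
  rw [h3] at h2
  rw [← h2]
  refine le_iSup₂_of_le (f := fun (α : ℝ≥0∞) (_ : 1 ≤ α) =>
    (hoeffdingFactor α : EReal) * ((r : EReal) - renyiDiv α ρ σ)) (ENNReal.ofReal (1 + u)) ?_ le_rfl
  rw [← ENNReal.ofReal_one]
  exact ENNReal.ofReal_le_ofReal (by linarith)

lemma exists_pos_forall_le_of_suppLE {X : Type*} [Finite X] {ρ σ : X → ℝ} (hσ : ∀ x, 0 ≤ σ x)
    (h : SuppLE ρ σ) : ∃ κ > 0, ∀ x, ρ x ≠ 0 → κ ≤ σ x := by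
  rcases Set.eq_empty_or_nonempty {x | ρ x ≠ 0} with he | hne
  · exact ⟨1, one_pos, fun x hx => absurd hx (Set.eq_empty_iff_forall_notMem.1 he x)⟩
  · obtain ⟨y, hy, hmin⟩ := Set.exists_min_image _ σ (Set.toFinite {x | ρ x ≠ 0}) hne
    exact ⟨σ y, (hσ y).lt_of_ne' fun h0 => hy (h y h0), fun x hx => hmin x hx⟩

/-- The trade-off of the Hoeffding anti-divergence is approximated by a state `τ` and an e-value
positive on its support. -/
lemma exists_state_eValue {X : Type*} [Fintype X] {C : Set (X → ℝ)} (hC : Convex ℝ C)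
    (hCc : IsCompact C) (hCs : C ⊆ stdSimplex ℝ X) {ρ σ₀ : X → ℝ} (hρ : ρ ∈ stdSimplex ℝ X)
    (hσ₀ : σ₀ ∈ C) (h₀ : SuppLE ρ σ₀) {r : ℝ} (hr : 0 < r) {η : ℝ} (hη : 0 < η) :
    ∃ τ ∈ stdSimplex ℝ X, ∃ E ∈ eValues C, (∀ x, τ x ≠ 0 → 0 < ρ x) ∧ (∀ x, τ x ≠ 0 → 0 < E x) ∧
      ∃ σ ∈ C, ((klReal τ ρ + max (r - ∑ x, τ x * Real.log (E x)) 0 : ℝ) : EReal)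
        ≤ hoeffdingAnti r ρ σ + ((2 * η : ℝ) : EReal) := by
  -- `C` is contracted towards `σ₀` to keep `σ` away from zero on the support of `ρ`. An e-value for
  -- the contracted set `K` becomes one for `C` after scaling by `1 - ε = e^{-η}`, which lowers its
  -- mean logarithm by exactly `η`.
  set ε : ℝ := 1 - Real.exp (-η) with hε
  have hε1 : 1 - ε = Real.exp (-η) := by rw [hε]; ring
  have hε0 : 0 < ε := by
    have : Real.exp (-η) < 1 := by
      rw [← Real.exp_zero]
      exact Real.exp_lt_exp.2 (by linarith)
    linarith
  have hε' : 0 < 1 - ε := hε1 ▸ Real.exp_pos _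
  set K : Set (X → ℝ) := (fun σ => ε • σ₀ + (1 - ε) • σ) '' C with hK
  have hKC : K ⊆ C := by
    rintro _ ⟨σ, hσ, rfl⟩
    exact hC hσ₀ hσ hε0.le hε'.le (by ring)
  obtain ⟨κ, hκ, hκ'⟩ := exists_pos_forall_le_of_suppLE (hCs hσ₀).1 h₀
  have hlow : ∀ σ ∈ K, ∀ x, ρ x ≠ 0 → ε * κ ≤ σ x := by
    rintro _ ⟨σ, hσ, rfl⟩ x hx
    have h1 := mul_le_mul_of_nonneg_left (hκ' x hx) hε0.le
    have h2 := mul_nonneg hε'.le ((hCs hσ).1 x)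
    simp only [Pi.add_apply, Pi.smul_apply, smul_eq_mul]
    linarith
  have hεκ : 0 < ε * κ := mul_pos hε0 hκ
  obtain ⟨u, hu, σ, hσ, hE, hval⟩ := exists_approx_saddle hρ (hC.affinity _ _)
    (hCc.image (by fun_prop)) ⟨_, Set.mem_image_of_mem _ hσ₀⟩ (hKC.trans hCs) hεκ hlow hr hη
  have hσs := hCs (hKC hσ)
  set τ := tilt ρ σ u with hτ
  have hτs : τ ∈ stdSimplex ℝ X := tilt_mem_stdSimplex hρ σ u
  have hτ0 : ∀ x, τ x ≠ 0 → ρ x ≠ 0 := fun x hx h0 => hx (tilt_eq_zero h0 u)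
  have hσpos : ∀ x, ρ x ≠ 0 → 0 < σ x := fun x hx => hεκ.trans_le (hlow σ hσ x hx)
  have hE0 : ∀ x, 0 ≤ τ x / σ x := fun x => div_nonneg (hτs.1 x) (hσs.1 x)
  refine ⟨τ, hτs, fun x => (1 - ε) * (τ x / σ x), ⟨fun x => mul_nonneg hε'.le (hE0 x), ?_⟩,
    fun x hx => (hρ.1 x).lt_of_ne' (hτ0 x hx), fun x hx => mul_pos hε'
      (div_pos ((hτs.1 x).lt_of_ne' hx) (hσpos x (hτ0 x hx))), σ, hKC hσ, ?_⟩
  · intro σ' hσ'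
    refine le_trans (Finset.sum_le_sum fun x _ => ?_) (hE _ (Set.mem_image_of_mem _ hσ'))
    have h1 := mul_nonneg (mul_nonneg hε0.le ((hCs hσ₀).1 x)) (hE0 x)
    simp only [Pi.add_apply, Pi.smul_apply, smul_eq_mul]
    linarith
  · have hlog : ∑ x, τ x * Real.log ((1 - ε) * (τ x / σ x)) = klReal τ σ - η := by
      have h1 : ∀ x, τ x * Real.log ((1 - ε) * (τ x / σ x))
          = τ x * (Real.log (τ x) - Real.log (σ x)) - τ x * η := by
        intro x
        by_cases hx : τ x = 0
        · simp [hx]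
        · have hσx := (hσpos x (hτ0 x hx)).ne'
          rw [Real.log_mul hε'.ne' (div_ne_zero hx hσx), Real.log_div hx hσx, hε1, Real.log_exp]
          ring
      rw [Finset.sum_congr rfl fun x _ => h1 x, Finset.sum_sub_distrib, ← Finset.sum_mul, hτs.2,
        one_mul, klReal]
    have h2 : klReal τ ρ + max (r - ∑ x, τ x * Real.log ((1 - ε) * (τ x / σ x))) 0
        ≤ hoeffdingValue r ρ σ u + 2 * η := by
      rw [hlog]
      have : max (r - (klReal τ σ - η)) 0 ≤ max (r - klReal τ σ) 0 + η :=
        max_le (by linarith [le_max_left (r - klReal τ σ) 0])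
          (by linarith [le_max_right (r - klReal τ σ) 0])
      linarith
    refine (EReal.coe_le_coe_iff.2 h2).trans ?_
    rw [EReal.coe_add]
    gcongr
    refine hoeffdingValue_le_hoeffdingAnti hρ hσs (fun x hx => ?_) r hu
    by_contra h
    exact (hσpos x h).ne' hx

/-- A dense sequence in `A` works, as `τ(log F)` is continuous at an `F` positive on the support of
`τ`. The sequence does not depend on `τ`, which is what allows an uncountable `R`. -/
lemma exists_seq_sum_mul_log_lt {X : Type*} [Fintype X] (A : Set (X → ℝ)) (hA : A.Nonempty) :
    ∃ E : ℕ → X → ℝ, (∀ j, E j ∈ A) ∧ ∀ (τ : X → ℝ), ∀ F ∈ A, (∀ x, τ x ≠ 0 → 0 < F x) →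
      ∀ ζ > 0, ∃ j, (∀ x, τ x ≠ 0 → 0 < E j x) ∧
        ∑ x, τ x * Real.log (F x) - ζ < ∑ x, τ x * Real.log (E j x) := by
  have : Nonempty A := hA.to_subtype
  refine ⟨fun j => TopologicalSpace.denseSeq A j, fun j => (TopologicalSpace.denseSeq A j).2, ?_⟩
  intro τ F hF hpos ζ hζ
  have hcont : ContinuousAt (fun G : A => ∑ x, τ x * Real.log (G.1 x)) ⟨F, hF⟩ := by
    refine tendsto_finsetSum _ fun x _ => ?_
    by_cases hx : τ x = 0
    · simp [hx]
    · refine Tendsto.const_mul _ (Tendsto.log ?_ (hpos x hx).ne')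
      exact (((continuous_apply x).comp continuous_subtype_val).tendsto (⟨F, hF⟩ : A))
  have h1 : ∀ᶠ G : A in nhds ⟨F, hF⟩,
      ∑ x, τ x * Real.log (F x) - ζ < ∑ x, τ x * Real.log (G.1 x) :=
    hcont.eventually_const_lt (by linarith)
  have h2 : ∀ᶠ G : A in nhds ⟨F, hF⟩, ∀ x, τ x ≠ 0 → 0 < G.1 x := by
    rw [eventually_all]
    intro x
    by_cases hx : τ x = 0
    · simp [hx]
    · filter_upwards [(((continuous_apply x).comp continuous_subtype_val).tendsto
        (⟨F, hF⟩ : A)).eventually_const_lt (hpos x hx)] with G hG _ using hG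
  obtain ⟨U, hU, hUo, hmem⟩ := eventually_nhds_iff.1 (h1.and h2)
  obtain ⟨j, hj⟩ := (TopologicalSpace.denseRange_denseSeq A).exists_mem_open hUo ⟨_, hmem⟩
  exact ⟨j, (hU _ hj).2, (hU _ hj).1⟩

theorem scExponentRelaxed0_adversarial_le {X : Type*} [Fintype X] {R C : Set (X → ℝ)}
    (hR : R ⊆ stdSimplex ℝ X) (hC : Convex ℝ C) (hCc : IsCompact C) (hCs : C ⊆ stdSimplex ℝ X)
    (hRC : ∀ ρ ∈ R, ∃ σ ∈ C, SuppLE ρ σ) {r : ℝ} (hr : 0 < r) :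
    scExponentRelaxed0 r (iidFamily R) (adversarial C) ≤ hoeffdingAntiSet r R C := by
  obtain ⟨E, hE, hdense⟩ := exists_seq_sum_mul_log_lt (eValues C) ⟨0, zero_mem_eValues C⟩
  have hE0 : ∀ j x, 0 ≤ E j x := fun j => (hE j).1
  have hT := fun n => isTest_mixtureTest r hE0 n
  refine iInf_le_of_le (mixtureTest r E) (iInf₂_le_of_le hT
    (le_typeIIRate_mixtureTest (fun σ hσ => (hCs hσ).1) r hE) (iSup_le ?_))
  rintro ⟨ρ, hρR⟩
  have hρ := hR hρR
  obtain ⟨σ₀, hσ₀, h₀⟩ := hRC ρ hρR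
  change successRate (fun n => {iid ρ n}) (mixtureTest r E) ≤ _
  -- Of the `3 * η`, two come from `exists_state_eValue` and one from replacing `F` by a member of
  -- the sequence.
  have key : ∀ η : ℝ, 0 < η → successRate (fun n => {iid ρ n}) (mixtureTest r E)
      ≤ hoeffdingAntiSet r R C + ((3 * η : ℝ) : EReal) := by
    intro η hη
    obtain ⟨τ, hτ, F, hF, hτρ, hτF, σ, hσ, hval⟩ :=
      exists_state_eValue hC hCc hCs hρ hσ₀ h₀ hr hη
    obtain ⟨j, hj, hjlog⟩ := hdense τ F hF hτF η hη
    rw [successRate_iid hρ hT]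
    refine (limsup_rate_le (F := E j) (r := r) hρ.1 hτ hτρ hj (fun n x => (hT n x).1) ?_).trans ?_
    · filter_upwards [eventually_gt_atTop j] with n hn x using le_mixtureTest r hE0 hn x
    · have h1 : klReal τ ρ + max (r - ∑ x, τ x * Real.log (E j x)) 0
          ≤ klReal τ ρ + max (r - ∑ x, τ x * Real.log (F x)) 0 + η := by
        rw [add_assoc]
        refine add_le_add le_rfl (max_le ?_ ?_)
        · linarith [le_max_left (r - ∑ x, τ x * Real.log (F x)) 0]
        · linarith [le_max_right (r - ∑ x, τ x * Real.log (F x)) 0]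
      have h2 : hoeffdingAnti r ρ σ ≤ hoeffdingAntiSet r R C :=
        le_trans (le_iSup₂ (f := fun σ (_ : σ ∈ C) => hoeffdingAnti r ρ σ) σ hσ)
          (le_iSup₂ (f := fun ρ (_ : ρ ∈ R) => ⨆ σ ∈ C, hoeffdingAnti r ρ σ) ρ hρR)
      refine (EReal.coe_le_coe_iff.2 h1).trans ?_
      rw [EReal.coe_add]
      calc _ ≤ hoeffdingAntiSet r R C + ((2 * η : ℝ) : EReal) + (η : EReal) := by
            gcongr
            exact hval.trans (by gcongr)
        _ = _ := by
            rw [add_assoc, ← EReal.coe_add]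
            congr 2
            ring
  generalize hoeffdingAntiSet r R C = H at key
  induction H with
  | bot => simpa using key 1 one_pos
  | top => exact le_top
  | coe h =>
    refine EReal.le_of_forall_lt_iff_le.1 fun z hz => ?_
    have hz' : h < z := by exact_mod_cast hz
    have := key ((z - h) / 3) (by linarith)
    rw [← EReal.coe_add] at this
    convert this using 2
    ring

/-! ### The sandwich -/

/-- A strict inequality makes the infimum of the relative entropies finite; this is how the
assumption on `R` and `S` enters, providing the centre `σ₀` of the contraction. -/
lemma exists_suppLE_of_iInf_lt {X : Type*} [Fintype X] {ρ : X → ℝ} {S : Set (X → ℝ)} {a : EReal}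
    (h : (⨅ σ ∈ S, relEntropy ρ σ) < a) : ∃ σ ∈ S, SuppLE ρ σ := by
  by_contra! hne
  refine not_top_lt (h.trans_le' (le_iInf₂ fun σ hσ => ?_))
  rw [relEntropy, if_neg (hne σ hσ)]

lemma hoeffdingAntiSet_le_scExponentRelaxed01 {X : Type*} [Fintype X] {R C : Set (X → ℝ)}
    (hR : R ⊆ stdSimplex ℝ X) (hC : C ⊆ stdSimplex ℝ X) (r : ℝ) :
    hoeffdingAntiSet r R C ≤ scExponentRelaxed01 r (iidFamily R) (iidFamily C) := by
  refine le_iInf fun T => le_iInf₂ fun hT hr => iSup₂_le fun ρ hρ => iSup₂_le fun σ hσ => ?_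
  have h1 : (r : EReal) ≤ typeIIRate (fun n => {iid σ n}) T :=
    hr.trans (iInf_le (fun j : C => typeIIRate (fun n => {iidFamily C j n}) T) ⟨σ, hσ⟩)
  exact (hoeffdingAnti_le_successRate (hR hρ) (hC hσ) hT h1).trans
    (le_iSup (fun i : R => successRate (fun n => {iidFamily R i n}) T) ⟨ρ, hρ⟩)

lemma scExponentRelaxed01_le_scExponentRelaxed0 {X : Type*} [Fintype X] (R C : Set (X → ℝ))
    (r : ℝ) : scExponentRelaxed01 r (iidFamily R) (iidFamily C)
      ≤ scExponentRelaxed0 r (iidFamily R) (compositeIID C) := by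
  refine le_iInf fun T => le_iInf₂ fun hT hr => iInf_le_of_le T (iInf₂_le hT (hr.trans ?_))
  refine le_iInf fun σ => typeIIRate_anti fun n => typeIIError_mono ?_ _
  exact Set.singleton_subset_iff.2 ⟨σ, σ.2, rfl⟩

/-- Places the simple exponents between the Hoeffding anti-divergence and the adversarial exponent,
so their supremum needs no achievability argument of its own. -/
lemma scSimple_le_scExponentRelaxed0_adversarial {X : Type*} [Fintype X] {R C : Set (X → ℝ)}
    {ρ σ : X → ℝ} (hρ : ρ ∈ R) (hσ : σ ∈ C) (r : ℝ) :
    scSimple r ρ σ ≤ scExponentRelaxed0 r (iidFamily R) (adversarial C) :=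
  le_iInf fun T => le_iInf₂ fun hT hr => iInf_le_of_le T (iInf₂_le_of_le hT (hr.trans
    (typeIIRate_anti fun n => typeIIError_mono (Set.singleton_subset_iff.2
      (arbVarying_subset_adversarial C n (compositeIID_subset_arbVarying C n ⟨σ, hσ, rfl⟩))) _))
    (le_iSup (fun i : R => successRate (fun n => {iidFamily R i n}) T) ⟨ρ, hρ⟩))

lemma hoeffdingAnti_le_scSimple {X : Type*} [Fintype X] {ρ σ : X → ℝ} (hρ : ρ ∈ stdSimplex ℝ X)
    (hσ : σ ∈ stdSimplex ℝ X) (r : ℝ) : hoeffdingAnti r ρ σ ≤ scSimple r ρ σ :=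
  le_iInf fun _ => le_iInf₂ fun hT hr => hoeffdingAnti_le_successRate hρ hσ hT hr

end StateDiscrimination

open StateDiscrimination in
theorem mainTheorem3 {X : Type*} [Fintype X] (R S : Set (X → ℝ))
    (hR : R ⊆ stdSimplex ℝ X) (hS : S ⊆ stdSimplex ℝ X)
    (hRS : ∀ ρ ∈ R, (⨅ σ ∈ S, relEntropy ρ σ) < ⨅ σ ∈ S, maxRelEntropy ρ σ)
    (r : ℝ) (hr : 0 < r) :
    hoeffdingAntiSet r R (closure (convexHull ℝ S))
        = (⨆ ρ ∈ R, ⨆ σ ∈ closure (convexHull ℝ S), scSimple r ρ σ) ∧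
      scExponentRelaxed0 r (iidFamily R) (adversarial (closure (convexHull ℝ S)))
        = hoeffdingAntiSet r R (closure (convexHull ℝ S)) ∧
      scExponentRelaxed0 r (iidFamily R) (adversarial S)
        = hoeffdingAntiSet r R (closure (convexHull ℝ S)) ∧
      scExponentRelaxed0 r (iidFamily R) (arbVarying S)
        = hoeffdingAntiSet r R (closure (convexHull ℝ S)) ∧
      scExponentRelaxed0 r (iidFamily R) (arbVarying (closure (convexHull ℝ S)))
        = hoeffdingAntiSet r R (closure (convexHull ℝ S)) ∧
      scExponentRelaxed0 r (iidFamily R) (compositeIID (closure (convexHull ℝ S)))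
        = hoeffdingAntiSet r R (closure (convexHull ℝ S)) ∧
      scExponentRelaxed01 r (iidFamily R) (iidFamily (closure (convexHull ℝ S)))
        = hoeffdingAntiSet r R (closure (convexHull ℝ S)) := by
  set C := closure (convexHull ℝ S) with hCdef
  have hSC : S ⊆ C := (subset_convexHull ℝ S).trans subset_closure
  have hCs : C ⊆ stdSimplex ℝ X :=
    closure_minimal (convexHull_min hS (convex_stdSimplex ℝ X)) (isClosed_stdSimplex ℝ X)
  have hCconv : Convex ℝ C := (convex_convexHull ℝ S).closure
  have hCc : IsCompact C := (isCompact_stdSimplex ℝ X).of_isClosed_subset isClosed_closure hCs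
  have hRC : ∀ ρ ∈ R, ∃ σ ∈ C, SuppLE ρ σ := fun ρ hρ =>
    let ⟨σ, hσ, h⟩ := exists_suppLE_of_iInf_lt (hRS ρ hρ)
    ⟨σ, hSC hσ, h⟩
  have h₁ := hoeffdingAntiSet_le_scExponentRelaxed01 hR hCs r
  have h₂ := scExponentRelaxed01_le_scExponentRelaxed0 R C r
  have h₃ := scExponentRelaxed0_mono r (iidFamily R)
    fun n T => typeIIError_mono (compositeIID_subset_arbVarying C n) T
  have h₄ := scExponentRelaxed0_mono r (iidFamily R)
    fun n T => typeIIError_arbVarying_closure_convexHull S n T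
  have h₅ := scExponentRelaxed0_mono r (iidFamily R)
    fun n T => typeIIError_mono (arbVarying_subset_adversarial S n) T
  have h₆ := scExponentRelaxed0_mono r (iidFamily R)
    fun n T => typeIIError_mono (adversarial_mono hSC n) T
  have h₇ := scExponentRelaxed0_adversarial_le hR hCconv hCc hCs hRC hr
  rw [← hCdef] at h₄
  refine ⟨le_antisymm ?_ ?_, le_antisymm h₇ ?_, le_antisymm ?_ ?_, le_antisymm ?_ ?_,
    le_antisymm ?_ ?_, le_antisymm ?_ ?_, le_antisymm ?_ h₁⟩
  · exact iSup₂_mono fun ρ hρ => iSup₂_mono fun σ hσ => hoeffdingAnti_le_scSimple (hR hρ) (hCs hσ) r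
  · exact iSup₂_le fun ρ hρ => iSup₂_le fun σ hσ =>
      (scSimple_le_scExponentRelaxed0_adversarial hρ hσ r).trans h₇
  · exact h₁.trans (h₂.trans (h₃.trans (h₄.trans (h₅.trans h₆))))
  · exact h₆.trans h₇
  · exact h₁.trans (h₂.trans (h₃.trans (h₄.trans h₅)))
  · exact h₅.trans (h₆.trans h₇)
  · exact h₁.trans (h₂.trans (h₃.trans h₄))
  · exact h₄.trans (h₅.trans (h₆.trans h₇))
  · exact h₁.trans (h₂.trans h₃)
  · exact h₃.trans (h₄.trans (h₅.trans (h₆.trans h₇)))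
  · exact h₁.trans h₂
  · exact h₂.trans (h₃.trans (h₄.trans (h₅.trans (h₆.trans h₇))))
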